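/- Let $\sigma_{00}=\mathbb I$, $\sigma_{01}=X$, $\sigma_{10}=Z$, $\sigma_{11}=Y$ be the Pauli matrices, let $|\Phi_{00}\rangle=(|00\rangle+|11\rangle)/\sqrt2$ and $|\Phi_m\rangle=(\mathbb I\otimes\sigma_m)|\Phi_{00}\rangle$ for $m\in F_2^2$ be the Bell states, and let $\mathbf p=(p_m)_{m\in F_2^2}$ be a probability vector with entropy $H(\mathbf p)=-\sum_m p_m\log_2 p_m$. For $\mathbf m=(m_1,\dots,m_N)\in F_2^{2N}$ put $q_{\mathbf m}=\prod_n p_{m_n}$, $\sigma_{\mathbf m}=\bigotimes_n\sigma_{m_n}$ and $|\Psi_{\mathbf m}\rangle=\bigotimes_n|\Phi_{m_n}\rangle$, where Alice holds the first and Bob the second qubit of each pair. Let $\gamma^{(N)}(\mathbf p)$ be the supremum of $\sum_{\mathbf m}q_{\mathbf m}\langle\Psi_{\mathbf m}|M_{\mathbf m}|\Psi_{\mathbf m}\rangle$ over all POVMs $\{M_{\mathbf m}\}$ implemented by local operations and classical communication (LOCC) between Alice and Bob, and let $\gamma_1^{(N)}(\mathbf p)$ be the supremum over the one-way LOCC POVMs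 $M_{\mathbf m}=\sum_a A_a\otimes B_{\mathbf m|a}$, where $\{A_a\}_a$ and, for each $a$, $\{B_{\mathbf m|a}\}_{\mathbf m}$ are POVMs. (1) Suppose $H(\mathbf p)<1$. Then $\gamma_1^{(N)}(\mathbf p)\to1$ as $N\to\infty$ and, since $\gamma_1^{(N)}(\mathbf p)\le\gamma^{(N)}(\mathbf p)$, also $\gamma^{(N)}(\mathbf p)\to1$. Moreover this is achieved by one-way schemes of the following form. For every $N$ there are linearly independent $\mathbf s(1),\dots,\mathbf s(N)\in F_2^{2N}$ with commuting $\sigma_{\mathbf s(n)}$, an orthonormal basis $\{|\psi_{\mathbf a}\rangle\}_{\mathbf a\in F_2^N}$ of $\mathbb C^{2^N}$ with $\sigma_{\mathbf s(n)}|\psi_{\mathbf a}\rangle=(-1)^{a_n}|\psi_{\mathbf a}\rangle$, unitaries $U_{\mathbf a}$ such that for all $\mathbf a$ and $\mathbf m$ the vectors $\sigma_{\mathbf m}|\psi_{\mathbf a}\rangle$ and $U_{\mathbf a}\sigma_{\mathbf m}|\psi_{\mathbf 0}\rangle$ agree up to a phase, and a decoder $\hat{\mathbf m}:F_2^N\to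 F_2^{2N}$ such that $\hat{\mathbf m}(\mathbf c)$ maximizes $q_{\mathbf m}$ among the $\mathbf m$ with syndrome $\mathbf c$, that is, with $\mathbf s(n)\odot\mathbf m=c_n$ for all $n$, where $\odot$ is the symplectic product. Alice measures in the orthonormal basis of the complex conjugates $|\psi_{\mathbf a}^*\rangle$ and sends the outcome $\mathbf a$ to Bob. Bob applies $U_{\mathbf a}^\dagger$, measures in the basis $\{|\psi_{\mathbf c}\rangle\}$, and guesses $\hat{\mathbf m}(\mathbf c)$. The success probability of this scheme tends to $1$ as $N\to\infty$. (2) If $H(\mathbf p)<1$ and $\mathbf p$ has at least three nonzero entries, then $\gamma^{(N)}(\mathbf p)<1$ for every $N\ge1$. (3) Consider the two-turn game in which the referee prepares $\rho=\sum_m p_m|\Phi_m\rangle\langle\Phi_m|\otimes|m\rangle\langle m|$ on $\mathcal A\otimes\mathcal B\otimes\mathcal R$, sends $\mathcal A$ to Alice and $\mathcal B$ to Bob, the players apply an LOCC operation $\mathcal M$ and return systems $\mathcal A',\mathcal B'$ of dimension $4$, and they win if the referee, measuring $\{R,\mathbb I-R\}$ with $R=\sum_m|m\rangle\langle m|\otimes|m\rangle\langle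 m|\otimes|m\rangle\langle m|$ on $\mathcal A'\otimes\mathcal B'\otimes\mathcal R$, obtains $R$. Let $\chi^{(N)}=\sup_{\mathcal M}\mathrm{tr}\big(R^{\otimes N}(\mathcal M\otimes\mathcal I)(\rho^{\otimes N})\big)$, over LOCC operations $\mathcal M$ on the $N$-fold systems, be the maximum winning probability of the $N$-times repeated game. Then $\chi^{(N)}=\gamma^{(N)}(\mathbf p)$ for all $N$ and all probability vectors $\mathbf p$. If $H(\mathbf p)<1$ and $\mathbf p$ has at least three nonzero entries, then $\chi^{(1)}<1$ while $\chi^{(N)}\to1$ as $N\to\infty$; so the parallel repetition conjecture, that $\chi^{(1)}<1$ implies the existence of a constant $c<1$ with $\chi^{(N)}<c^N$ for all $N\ge1$, fails for this game. Such probability vectors $\mathbf p$ exist. -/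

import Mathlib

open scoped Kronecker ComplexOrder Matrix

noncomputable section

namespace BellLOCC

/-! ### Measurements and quantum operations on finite-dimensional systems

A system with orthonormal basis labelled by a finite type `n` has operators `Matrix n n ℂ`. -/

/-- A positive-operator valued measure with finitely many outcomes. -/
def IsPOVM {n O : Type} [Fintype n] [DecidableEq n] [Fintype O]
    (M : O → Matrix n n ℂ) : Prop :=
  (∀ o, (M o).PosSemidef) ∧ ∑ o, M o = 1

/-- The completely positive map `ρ ↦ ∑ j, K j * ρ * (K j)ᴴ` with Kraus operators `K j`. -/
def krausMap {ι m n : Type} [Fintype ι] [Fintype n] (K : ι → Matrix m n ℂ) :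
    Matrix n n ℂ →ₗ[ℂ] Matrix m m ℂ where
  toFun ρ := ∑ j, K j * ρ * (K j)ᴴ
  map_add' ρ τ := by
    simp only [Matrix.mul_add, Matrix.add_mul, Finset.sum_add_distrib]
  map_smul' c ρ := by
    simp only [Matrix.mul_smul, Matrix.smul_mul, Finset.smul_sum, RingHom.id_apply]

/-- `IsLOCC A B J`: the family `J o` (one completely positive map for each value `o` of the final
classical record) is a quantum instrument from Alice's and Bob's systems `A`, `B` to their systems
`A'`, `B'` that is implemented by local operations and finitely many rounds of classical
communication. Either the parties halt and record a value `o`, or one of them applies a quantum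
instrument (outcome `k` has the Kraus operators `K k j`) to the system in his or her hands and
announces `k`, and they go on with a protocol that may depend on `k`. -/
inductive IsLOCC {A' B' O : Type} [DecidableEq O] : (A B : Type) →
    (O → Matrix (A × B) (A × B) ℂ →ₗ[ℂ] Matrix (A' × B') (A' × B') ℂ) → Prop
  | halt (o : O) : IsLOCC A' B' (fun o' => if o' = o then LinearMap.id else 0)
  | alice {A B A₁ : Type} [Fintype A] [DecidableEq A] [Fintype B] [DecidableEq B]
      [Fintype A₁] [DecidableEq A₁] {r s : ℕ} (K : Fin r → Fin s → Matrix A₁ A ℂ)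
      (hK : ∑ k, ∑ j, (K k j)ᴴ * K k j = 1)
      (J : Fin r → O → Matrix (A₁ × B) (A₁ × B) ℂ →ₗ[ℂ] Matrix (A' × B') (A' × B') ℂ)
      (hJ : ∀ k, IsLOCC A₁ B (J k)) :
      IsLOCC A B (fun o =>
        ∑ k, (J k o).comp (krausMap (fun j => K k j ⊗ₖ (1 : Matrix B B ℂ))))
  | bob {A B B₁ : Type} [Fintype A] [DecidableEq A] [Fintype B] [DecidableEq B]
      [Fintype B₁] [DecidableEq B₁] {r s : ℕ} (K : Fin r → Fin s → Matrix B₁ B ℂ)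
      (hK : ∑ k, ∑ j, (K k j)ᴴ * K k j = 1)
      (J : Fin r → O → Matrix (A × B₁) (A × B₁) ℂ →ₗ[ℂ] Matrix (A' × B') (A' × B') ℂ)
      (hJ : ∀ k, IsLOCC A B₁ (J k)) :
      IsLOCC A B (fun o =>
        ∑ k, (J k o).comp (krausMap (fun j => (1 : Matrix A A ℂ) ⊗ₖ K k j)))

/-- An LOCC operation (a channel): an LOCC protocol whose final record is discarded. -/
def IsLOCCChannel {A B A' B' : Type}
    (M : Matrix (A × B) (A × B) ℂ →ₗ[ℂ] Matrix (A' × B') (A' × B') ℂ) : Prop :=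
  IsLOCC (O := Unit) A B (fun _ => M)

/-- A POVM implemented by LOCC: the final record of some LOCC protocol applied to the state `ρ`
equals `o` with probability `tr (M o * ρ)`. -/
def IsLOCCPOVM {A B O : Type} [Fintype A] [Fintype B] [DecidableEq O]
    (M : O → Matrix (A × B) (A × B) ℂ) : Prop :=
  ∃ (A' B' : Type) (_ : Fintype A') (_ : Fintype B')
    (J : O → Matrix (A × B) (A × B) ℂ →ₗ[ℂ] Matrix (A' × B') (A' × B') ℂ),
    IsLOCC A B J ∧ ∀ o ρ, (J o ρ).trace = (M o * ρ).trace

/-- The POVM of a one-way protocol: Alice measures `E` and sends the outcome `a` to Bob, who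
measures `F a`; the result is Bob's outcome. -/
def oneWayPOVM {A B O ι : Type} [Fintype ι] (E : ι → Matrix A A ℂ) (F : ι → O → Matrix B B ℂ) :
    O → Matrix (A × B) (A × B) ℂ :=
  fun o => ∑ a, E a ⊗ₖ F a o

/-! ### The ensemble of Bell states and its `N`-fold repetition -/

/-- The labels `00, 01, 10, 11` of the Bell states. -/
abbrev Label : Type := ZMod 2 × ZMod 2

/-- The labels of the computational basis of `N` qubits. -/
abbrev Qubits (N : ℕ) : Type := Fin N → Fin 2

/-- The Pauli matrices `σ₀₀ = 1`, `σ₀₁ = X`, `σ₁₀ = Z`, `σ₁₁ = Y`. -/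
def pauli (m : Label) : Matrix (Fin 2) (Fin 2) ℂ :=
  if m = (0, 0) then 1
  else if m = (0, 1) then !![0, 1; 1, 0]
  else if m = (1, 0) then !![1, 0; 0, -1]
  else !![0, -Complex.I; Complex.I, 0]

/-- The tensor product of the Pauli matrices `σ_{m_n}`. -/
def pauliN {N : ℕ} (m : Fin N → Label) : Matrix (Qubits N) (Qubits N) ℂ :=
  Matrix.of fun x y => ∏ n, pauli (m n) (x n) (y n)

/-- `(|00⟩ + |11⟩) / √2`. -/
def bell₀ : Fin 2 × Fin 2 → ℂ :=
  fun x => if x.1 = x.2 then ((Real.sqrt 2 : ℝ) : ℂ)⁻¹ else 0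

/-- The Bell state `Φ_m = (1 ⊗ σ_m) Φ₀₀`. -/
def bell (m : Label) : Fin 2 × Fin 2 → ℂ :=
  ((1 : Matrix (Fin 2) (Fin 2) ℂ) ⊗ₖ pauli m) *ᵥ bell₀

/-- The tensor product of the Bell states `Φ_{m_n}`, with Alice's qubits grouped together and
Bob's qubits grouped together. -/
def bellN {N : ℕ} (m : Fin N → Label) : Qubits N × Qubits N → ℂ :=
  fun x => ∏ n, bell (m n) (x.1 n, x.2 n)

/-- The probability `q_m = ∏ p_{m_n}`. -/
def prob (p : Label → ℝ) {N : ℕ} (m : Fin N → Label) : ℝ := ∏ n, p (m n)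

/-- The entropy, in bits. -/
def entropy (p : Label → ℝ) : ℝ := -∑ m, p m * Real.logb 2 (p m)

/-- The probability of correctly identifying a state of the `N`-fold ensemble with the POVM `M`. -/
def successProb (p : Label → ℝ) {N : ℕ}
    (M : (Fin N → Label) → Matrix (Qubits N × Qubits N) (Qubits N × Qubits N) ℂ) : ℝ :=
  ∑ m, prob p m * (star (bellN m) ⬝ᵥ (M m *ᵥ bellN m)).re

/-- The LOCC success probability `γ^(N)(p)`. -/
def gammaLOCC (p : Label → ℝ) (N : ℕ) : ℝ :=
  sSup {x | ∃ M : (Fin N → Label) → Matrix (Qubits N × Qubits N) (Qubits N × Qubits N) ℂ,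
    IsLOCCPOVM M ∧ x = successProb p M}

/-- The one-way LOCC success probability `γ₁^(N)(p)`. -/
def gammaOneWay (p : Label → ℝ) (N : ℕ) : ℝ :=
  sSup {x | ∃ (r : ℕ) (E : Fin r → Matrix (Qubits N) (Qubits N) ℂ)
    (F : Fin r → (Fin N → Label) → Matrix (Qubits N) (Qubits N) ℂ),
    IsPOVM E ∧ (∀ a, IsPOVM (F a)) ∧ x = successProb p (oneWayPOVM E F)}

/-! ### The stabilizer measurement -/

/-- The projector `|v⟩⟨v|` (for a unit vector `v`). -/
def proj {n : Type} (v : n → ℂ) : Matrix n n ℂ := Matrix.vecMulVec v (star v)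

/-- The symplectic product of `u` and `v` over `F₂`. -/
def symp {N : ℕ} (u v : Fin N → Label) : ZMod 2 :=
  ∑ i, ((u i).1 * (v i).2 + (u i).2 * (v i).1)

/-- The data of the one-way scheme on `N` qubits: commuting independent Pauli operators
`σ_{s(1)}, …, σ_{s(N)}`, the orthonormal basis `ψ_a` that they stabilize up to the signs
`(-1)^{a_n}`, Bob's corrections `U_a`, and a maximum-likelihood decoder of syndromes. -/
structure StabilizerScheme (p : Label → ℝ) (N : ℕ) where
  s : Fin N → (Fin N → Label)
  independent : LinearIndependent (ZMod 2) s
  commute : ∀ i j, Commute (pauliN (s i)) (pauliN (s j))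
  ψ : (Fin N → ZMod 2) → (Qubits N → ℂ)
  orthonormal : ∀ a b, star (ψ a) ⬝ᵥ ψ b = if a = b then 1 else 0
  stabilized : ∀ a n, pauliN (s n) *ᵥ ψ a = (-1 : ℂ) ^ (a n).val • ψ a
  U : (Fin N → ZMod 2) → Matrix (Qubits N) (Qubits N) ℂ
  unitary : ∀ a, U a ∈ Matrix.unitaryGroup (Qubits N) ℂ
  corrects : ∀ a m, ∃ c : ℂ, ‖c‖ = 1 ∧
    pauliN m *ᵥ ψ a = c • (U a *ᵥ (pauliN m *ᵥ ψ 0))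
  decode : (Fin N → ZMod 2) → (Fin N → Label)
  decode_syndrome : ∀ c n, symp (s n) (decode c) = c n
  decode_max : ∀ c m, (∀ n, symp (s n) m = c n) → prob p m ≤ prob p (decode c)

/-- Alice measures in the stabilizer basis of the vectors `φ_a`, where `ψ_a` is the complex
conjugate of `φ_a`. -/
def StabilizerScheme.alice {p : Label → ℝ} {N : ℕ} (S : StabilizerScheme p N) :
    (Fin N → ZMod 2) → Matrix (Qubits N) (Qubits N) ℂ :=
  fun a => proj (star (S.ψ a))

/-- Bob's syndrome decoding: he measures in the basis `ψ_c` and guesses `decode c`. -/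
def StabilizerScheme.syndromeDecoding {p : Label → ℝ} {N : ℕ} (S : StabilizerScheme p N) :
    (Fin N → Label) → Matrix (Qubits N) (Qubits N) ℂ :=
  fun m => ∑ c, if S.decode c = m then proj (S.ψ c) else 0

/-- Bob's measurement for Alice's outcome `a`: he undoes `U_a`, then decodes the syndrome. -/
def StabilizerScheme.bob {p : Label → ℝ} {N : ℕ} (S : StabilizerScheme p N) :
    (Fin N → ZMod 2) → (Fin N → Label) → Matrix (Qubits N) (Qubits N) ℂ :=
  fun a m => S.U a * S.syndromeDecoding m * (S.U a)ᴴ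

/-! ### Two-turn games with two classically communicating players -/

/-- A two-turn game: the referee prepares the state `ρ` of `A ⊗ B ⊗ R`, sends `A` to Alice and `B`
to Bob, receives systems `A'` and `B'`, and measures `{W, 1 - W}` on `A' ⊗ B' ⊗ R`; the players
win with the outcome `W`. -/
structure TwoTurnGame (A B A' B' R : Type) [Fintype A] [Fintype B] [Fintype A'] [Fintype B']
    [Fintype R] [DecidableEq A'] [DecidableEq B'] [DecidableEq R] where
  ρ : Matrix ((A × B) × R) ((A × B) × R) ℂ
  ρ_pos : ρ.PosSemidef
  ρ_trace : ρ.trace = 1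
  W : Matrix ((A' × B') × R) ((A' × B') × R) ℂ
  W_pos : W.PosSemidef
  W_le : (1 - W).PosSemidef

/-- The map `M ⊗ id` on `C ⊗ R`, acting on each block `⟨r| X |r'⟩` by `M`. -/
def ampliate {C C' R : Type} (M : Matrix C C ℂ →ₗ[ℂ] Matrix C' C' ℂ)
    (X : Matrix (C × R) (C × R) ℂ) : Matrix (C' × R) (C' × R) ℂ :=
  Matrix.of fun x y => M (Matrix.of fun u v => X (u, x.2) (v, y.2)) x.1 y.1

/-- The `N`-fold tensor power of an operator on `A ⊗ B ⊗ R`, with the factors of each party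
grouped together. -/
def tensorPow {A B R : Type} (N : ℕ) (X : Matrix ((A × B) × R) ((A × B) × R) ℂ) :
    Matrix (((Fin N → A) × (Fin N → B)) × (Fin N → R))
      (((Fin N → A) × (Fin N → B)) × (Fin N → R)) ℂ :=
  Matrix.of fun x y => ∏ n, X ((x.1.1 n, x.1.2 n), x.2 n) ((y.1.1 n, y.1.2 n), y.2 n)

section Games

variable {A B A' B' R : Type} [Fintype A] [Fintype B] [Fintype A'] [Fintype B'] [Fintype R]
  [DecidableEq A'] [DecidableEq B'] [DecidableEq R]

/-- The maximum winning probability `χ^(N)` of the `N`-times repeated game, in which the players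
must win all the games; `χ^(1)` is that of the game itself. -/
def TwoTurnGame.value (G : TwoTurnGame A B A' B' R) (N : ℕ) : ℝ :=
  sSup {x | ∃ M : Matrix ((Fin N → A) × (Fin N → B)) ((Fin N → A) × (Fin N → B)) ℂ →ₗ[ℂ]
      Matrix ((Fin N → A') × (Fin N → B')) ((Fin N → A') × (Fin N → B')) ℂ,
    IsLOCCChannel M ∧ x = (tensorPow N G.W * ampliate M (tensorPow N G.ρ)).trace.re}

/-- The parallel repetition conjecture for the game `G`. -/
def TwoTurnGame.ParallelRepetition (G : TwoTurnGame A B A' B' R) : Prop :=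
  G.value 1 < 1 → ∃ c : ℝ, c < 1 ∧ ∀ N : ℕ, 1 ≤ N → G.value N < c ^ N

end Games

/-- `|m⟩⟨m|`. -/
def ketbra (m : Label) : Matrix Label Label ℂ := Matrix.single m m 1

/-- The referee's state `∑ p_m |Φ_m⟩⟨Φ_m| ⊗ |m⟩⟨m|`. -/
def bellGameState (p : Label → ℝ) :
    Matrix ((Fin 2 × Fin 2) × Label) ((Fin 2 × Fin 2) × Label) ℂ :=
  ∑ m, (p m : ℂ) • (proj (bell m) ⊗ₖ ketbra m)

/-- The referee's test `∑ |m⟩⟨m| ⊗ |m⟩⟨m| ⊗ |m⟩⟨m|`. -/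
def bellGameTest : Matrix ((Label × Label) × Label) ((Label × Label) × Label) ℂ :=
  ∑ m, (ketbra m ⊗ₖ ketbra m) ⊗ₖ ketbra m

theorem ketbra_posSemidef (m : Label) : (ketbra m).PosSemidef := by
  have h : ketbra m = Matrix.diagonal (Pi.single m 1) := by
    rw [ketbra, Matrix.diagonal_single]
  rw [h, Matrix.posSemidef_diagonal_iff]
  intro i
  by_cases hi : i = m
  · subst hi; simp
  · simp [hi]

theorem proj_posSemidef {n : Type} [Fintype n] (v : n → ℂ) : (proj v).PosSemidef :=
  Matrix.posSemidef_vecMulVec_self_star v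

theorem bell_trace (m : Label) : (proj (bell m)).trace = 1 := by
  have h2 : ((Real.sqrt 2 : ℝ) : ℂ)⁻¹ * ((Real.sqrt 2 : ℝ) : ℂ)⁻¹ = 1 / 2 := by
    rw [← mul_inv, ← Complex.ofReal_mul, Real.mul_self_sqrt (by norm_num)]
    norm_num
  rw [proj, Matrix.trace_vecMulVec]
  have hm : m = (0, 0) ∨ m = (0, 1) ∨ m = (1, 0) ∨ m = (1, 1) := by
    revert m; decide
  rcases hm with rfl | rfl | rfl | rfl <;>
  · simp [dotProduct, Fintype.sum_prod_type, bell, bell₀, pauli, Matrix.mulVec,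
      Matrix.one_apply, Complex.conj_ofReal]
    first
    | linear_combination 2 * h2
    | linear_combination 2 * h2 - 2 * ((Real.sqrt 2 : ℝ) : ℂ)⁻¹ ^ 2 * Complex.I_sq

theorem bellGameTest_eq : bellGameTest =
    Matrix.diagonal (fun x => if x.1.1 = x.2 ∧ x.1.2 = x.2 then 1 else 0) := by
  ext ⟨⟨a, b⟩, r⟩ ⟨⟨a', b'⟩, r'⟩
  simp only [bellGameTest, ketbra, Matrix.sum_apply, Matrix.kroneckerMap_apply,
    Matrix.single_apply, Matrix.diagonal_apply, Prod.mk.injEq]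
  rw [Finset.sum_eq_single r]
  · grind
  · intro m _ hm
    simp [hm]
  · simp

/-- Identification of a state of the Bell ensemble as a two-turn game. -/
def bellGame (p : Label → ℝ) (hp : p ∈ stdSimplex ℝ Label) :
    TwoTurnGame (Fin 2) (Fin 2) Label Label Label where
  ρ := bellGameState p
  ρ_pos := by
    refine Matrix.posSemidef_sum _ fun m _ => ?_
    refine Matrix.PosSemidef.smul ?_ (Complex.zero_le_real.mpr (hp.1 m))
    exact (proj_posSemidef _).kronecker (ketbra_posSemidef m)
  ρ_trace := by
    have h : ((∑ m, p m : ℝ) : ℂ) = 1 := by rw [hp.2]; simp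
    rw [bellGameState, Matrix.trace_sum, ← h, Complex.ofReal_sum]
    refine Finset.sum_congr rfl fun m _ => ?_
    rw [Matrix.trace_smul, Matrix.trace_kronecker, bell_trace, ketbra,
      Matrix.trace_single_eq_same]
    simp
  W := bellGameTest
  W_pos := by
    rw [bellGameTest_eq, Matrix.posSemidef_diagonal_iff]
    intro x
    split_ifs <;> simp
  W_le := by
    rw [bellGameTest_eq, ← Matrix.diagonal_one, Matrix.diagonal_sub,
      Matrix.posSemidef_diagonal_iff]
    intro x
    split_ifs <;> simp

end BellLOCC

end

noncomputable section

namespace BellLOCC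

variable {N : ℕ}

/-! ### Signs -/

/-! If Alice projects her half of a product of Bell states onto the conjugate of `v`, Bob's half is
left in the state `pauliN m *ᵥ v`. For a stabilizer basis vector `ψ a` this equals, up to a phase,
`U a` applied to `pauliN m *ᵥ ψ 0`, which is a joint eigenvector carrying the syndrome of `m`.
Identifying the Bell states thus becomes syndrome decoding of a Pauli error, and success means
exactly that the decoder returns `m` (`successProb_eq`).

A good stabilizer exists by random coding over graph states. For a uniform matrix `A`, two given
distinct errors share a syndrome with probability at most `2 / 2 ^ N`. At most `1 / q` errors are as
likely as one of probability `q > 0`, so its failure probability is at most `min 1 (δ / q) ≤ (δ / q)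
^ s` with `δ = 2 / 2 ^ N` and `0 ≤ s ≤ 1`. Averaging over errors gives `2 ^ s * (2 ^ (-s) * ∑ a, p a
^ (1 - s)) ^ N`. The base is 1 at `s = 0` with slope `(H - 1) log 2`, so it is below 1 for small `s
> 0` when `H < 1` (`exists_rpow_sum_lt_one`).

For the converse at finite `N`, LOCC maps have product Kraus operators, and a product operator `K ⊗
L` responds to a maximally entangled state with at most `2 ^ (-N)` times its total trace weight.
Summed over outcomes, the probabilities of correct answers are at most `2 ^ N`, while at least `3 ^
N` states occur (`gammaLOCC_lt_one`).

A game strategy and a measurement convert into each other: Alice can measure the label she would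
return, and both parties can prepare a label they have both learned (`value_bellGame`). Hence the
game values tend to 1 although the single game is not won with certainty, which excludes exponential
decay. -/

theorem neg_one_pow_val_add (a b : ZMod 2) :
    (-1 : ℂ) ^ (a + b).val = (-1) ^ a.val * (-1) ^ b.val := by
  revert a b
  have h : ∀ a b : ZMod 2, (a + b).val % 2 = (a.val + b.val) % 2 := by decide
  intro a b
  rw [← pow_add, neg_one_pow_eq_pow_mod_two, h, ← neg_one_pow_eq_pow_mod_two]

theorem neg_one_pow_val_sum {ι : Type} (s : Finset ι) (f : ι → ZMod 2) :
    (-1 : ℂ) ^ (∑ i ∈ s, f i).val = ∏ i ∈ s, (-1) ^ (f i).val := by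
  classical
  induction s using Finset.induction_on with
  | empty => simp
  | insert i s hi ih => rw [Finset.sum_insert hi, Finset.prod_insert hi, neg_one_pow_val_add, ih]

theorem neg_one_pow_val_injective {a b : ZMod 2} (h : (-1 : ℂ) ^ a.val = (-1) ^ b.val) : a = b := by
  revert a b
  have h01 : ∀ a : ZMod 2, a = 0 ∨ a = 1 := by decide
  intro a b h
  rcases h01 a with rfl | rfl <;> rcases h01 b with rfl | rfl <;>
    first
    | rfl
    | (exfalso; revert h; simp [ZMod.val_one]; try norm_num)

theorem neg_one_pow_mul_self (k : ℕ) : (-1 : ℂ) ^ k * (-1) ^ k = 1 := by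
  rw [← mul_pow]; simp

/-! ### Pauli operators -/

theorem label_cases (m : Label) : m = (0, 0) ∨ m = (0, 1) ∨ m = (1, 0) ∨ m = (1, 1) := by
  revert m; decide

theorem pauli_mul_comm (u v : Label) :
    pauli u * pauli v = (-1 : ℂ) ^ (u.1 * v.2 + u.2 * v.1).val • (pauli v * pauli u) := by
  rcases label_cases u with rfl | rfl | rfl | rfl <;>
  rcases label_cases v with rfl | rfl | rfl | rfl <;>
  · simp [pauli, ZMod.val_one, show (1 + 1 : ZMod 2) = 0 from rfl]

theorem pauli_conjTranspose (u : Label) : (pauli u)ᴴ = pauli u := by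
  rcases label_cases u with rfl | rfl | rfl | rfl <;>
  · ext i j
    fin_cases i <;> fin_cases j <;> simp [pauli]

theorem pauli_mul_self (u : Label) : pauli u * pauli u = 1 := by
  rcases label_cases u with rfl | rfl | rfl | rfl <;>
  · ext i j
    fin_cases i <;> fin_cases j <;> simp [pauli]

/-- The labels of the computational basis of a qubit as elements of `F₂`. -/
def bit : Fin 2 ≃ ZMod 2 := Equiv.refl (Fin 2)

theorem bit_zero : bit 0 = 0 := rfl

theorem bit_one : bit 1 = 1 := rfl

/-- The entries of a Pauli matrix other than `Y`. -/
theorem pauli_apply_of_mul_eq_zero (u : Label) (h : u.1 * u.2 = 0) (i j : Fin 2) :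
    pauli u i j = if bit j = bit i + u.2 then (-1 : ℂ) ^ (u.1 * bit i).val else 0 := by
  rcases label_cases u with rfl | rfl | rfl | rfl <;> fin_cases i <;> fin_cases j <;>
  first
  | exact absurd h (by decide)
  | simp [pauli, ZMod.val_one, show (1 + 1 : ZMod 2) = 0 from rfl, bit_zero, bit_one]

/-- The product of two tensor products of operators on the qubits. -/
theorem prod_mul_prod (P Q : Fin N → Matrix (Fin 2) (Fin 2) ℂ) :
    (Matrix.of fun x y : Qubits N => ∏ n, P n (x n) (y n)) *
      (Matrix.of fun x y : Qubits N => ∏ n, Q n (x n) (y n)) =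
    Matrix.of fun x y => ∏ n, (P n * Q n) (x n) (y n) := by
  ext x y
  simp only [Matrix.mul_apply, Matrix.of_apply, ← Finset.prod_mul_distrib]
  rw [Finset.prod_univ_sum, Fintype.piFinset_univ]

theorem pauliN_mul_comm (u v : Fin N → Label) :
    pauliN u * pauliN v = (-1 : ℂ) ^ (symp u v).val • (pauliN v * pauliN u) := by
  rw [pauliN, pauliN, prod_mul_prod, prod_mul_prod, symp, neg_one_pow_val_sum]
  ext x y
  simp only [Matrix.smul_apply, Matrix.of_apply, smul_eq_mul, ← Finset.prod_mul_distrib]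
  refine Finset.prod_congr rfl fun n _ => ?_
  rw [pauli_mul_comm, Matrix.smul_apply, smul_eq_mul]

theorem pauliN_conjTranspose (u : Fin N → Label) : (pauliN u)ᴴ = pauliN u := by
  ext x y
  simp only [pauliN, Matrix.conjTranspose_apply, Matrix.of_apply, star_prod]
  refine Finset.prod_congr rfl fun n _ => ?_
  rw [← Matrix.conjTranspose_apply, pauli_conjTranspose]

theorem pauliN_mul_self (u : Fin N → Label) : pauliN u * pauliN u = 1 := by
  rw [pauliN, prod_mul_prod]
  ext x y
  simp only [pauli_mul_self, Matrix.of_apply, Matrix.one_apply]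
  rw [Fintype.prod_ite_zero]
  simp [funext_iff]

theorem pauliN_mem_unitaryGroup (u : Fin N → Label) :
    pauliN u ∈ Matrix.unitaryGroup (Qubits N) ℂ := by
  rw [Matrix.mem_unitaryGroup_iff, Matrix.star_eq_conjTranspose, pauliN_conjTranspose,
    pauliN_mul_self]

theorem star_mulVec_dotProduct {n : Type} [Fintype n] (H : Matrix n n ℂ) (v w : n → ℂ) :
    star (H *ᵥ v) ⬝ᵥ w = star v ⬝ᵥ (Hᴴ *ᵥ w) := by
  rw [Matrix.star_mulVec, ← Matrix.dotProduct_mulVec]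

/-- Eigenvectors of a Pauli operator for different eigenvalues are orthogonal. -/
theorem dotProduct_eq_zero_of_pauliN_eigen (u : Fin N → Label) {v w : Qubits N → ℂ} {a b : ZMod 2}
    (hv : pauliN u *ᵥ v = (-1 : ℂ) ^ a.val • v) (hw : pauliN u *ᵥ w = (-1 : ℂ) ^ b.val • w)
    (hab : a ≠ b) : star v ⬝ᵥ w = 0 := by
  have h := star_mulVec_dotProduct (pauliN u) v w
  rw [pauliN_conjTranspose, hv, hw, star_smul, smul_dotProduct, dotProduct_smul, star_pow,
    star_neg, star_one, smul_eq_mul, smul_eq_mul] at h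
  by_contra h0
  exact hab (neg_one_pow_val_injective (mul_right_cancel₀ h0 h))

/-- A Pauli operator permutes the joint eigenspaces of other Pauli operators. -/
theorem pauliN_mulVec_pauliN_mulVec (u m : Fin N → Label) {v : Qubits N → ℂ} {a : ZMod 2}
    (hv : pauliN u *ᵥ v = (-1 : ℂ) ^ a.val • v) :
    pauliN u *ᵥ (pauliN m *ᵥ v) = (-1 : ℂ) ^ (symp u m + a).val • (pauliN m *ᵥ v) := by
  rw [Matrix.mulVec_mulVec, pauliN_mul_comm, Matrix.smul_mulVec, ← Matrix.mulVec_mulVec, hv,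
    Matrix.mulVec_smul, smul_smul, neg_one_pow_val_add]

theorem star_pauliN_mulVec_dotProduct (m : Fin N → Label) (v : Qubits N → ℂ) :
    star (pauliN m *ᵥ v) ⬝ᵥ (pauliN m *ᵥ v) = star v ⬝ᵥ v := by
  rw [star_mulVec_dotProduct, pauliN_conjTranspose, Matrix.mulVec_mulVec, pauliN_mul_self,
    Matrix.one_mulVec]

/-! ### Graph states -/

/-- The operator `X_n ∏ k, Z_k ^ (A + Aᵀ) k n`. -/
def graphStabilizer (A : Matrix (Fin N) (Fin N) (ZMod 2)) (n : Fin N) : Fin N → Label :=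
  fun k => (A k n + A n k, if k = n then 1 else 0)

/-- The exponent of the sign of the graph state. -/
def graphForm (A : Matrix (Fin N) (Fin N) (ZMod 2)) (x : Fin N → ZMod 2) : ZMod 2 :=
  ∑ i, ∑ j, A i j * x i * x j + ∑ i, A i i * x i

/-- The graph state vector. -/
def graphState (A : Matrix (Fin N) (Fin N) (ZMod 2)) : Qubits N → ℂ :=
  fun x => ((Real.sqrt 2 : ℝ) : ℂ)⁻¹ ^ N * (-1 : ℂ) ^ (graphForm A (bit ∘ x)).val

/-- The tensor product of the powers `Z ^ a_n`. -/
def zLabel (a : Fin N → ZMod 2) : Fin N → Label := fun n => (a n, 0)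

theorem inv_sqrt_two_mul_self :
    ((Real.sqrt 2 : ℝ) : ℂ)⁻¹ * ((Real.sqrt 2 : ℝ) : ℂ)⁻¹ = 2⁻¹ := by
  rw [← mul_inv, ← Complex.ofReal_mul, Real.mul_self_sqrt (by norm_num)]
  norm_num

theorem star_graphState_dotProduct (A : Matrix (Fin N) (Fin N) (ZMod 2)) :
    star (graphState A) ⬝ᵥ graphState A = 1 := by
  have h : ∀ x : Qubits N, star (graphState A) x * graphState A x = 2⁻¹ ^ N := by
    intro x
    simp only [Pi.star_apply, graphState, star_mul', star_pow, star_neg, star_one, star_inv₀,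
      Complex.star_def, Complex.conj_ofReal]
    rw [mul_mul_mul_comm, ← mul_pow, inv_sqrt_two_mul_self, neg_one_pow_mul_self, mul_one]
  simp only [dotProduct, h, Finset.sum_const, Finset.card_univ, Fintype.card_pi, Fintype.card_fin,
    Finset.prod_const, nsmul_eq_mul]
  push_cast
  rw [← mul_pow]
  norm_num

/-- In `F₂` one has `x i ^ 2 = x i`, so the linear part of `graphForm` cancels the diagonal of the
quadratic part; otherwise a term `A n n` would be left over. This is what allows `A` to range over
all matrices, although only `A + Aᵀ` matters. -/
theorem graphForm_add_single (A : Matrix (Fin N) (Fin N) (ZMod 2)) (x : Fin N → ZMod 2)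
    (n : Fin N) :
    graphForm A (x + Pi.single n 1) = graphForm A x + ∑ k, (A k n + A n k) * x k := by
  have h2 : ∀ a : ZMod 2, a + a = 0 := by decide
  simp only [graphForm, Pi.add_apply, mul_add, add_mul, Finset.sum_add_distrib]
  simp only [Pi.single_apply, mul_ite, ite_mul, mul_one, mul_zero, zero_mul, Finset.sum_ite_eq',
    Finset.mem_univ, if_true, Finset.sum_ite_irrel, Finset.sum_const_zero]
  linear_combination h2 (A n n)

theorem pauliN_graphStabilizer_apply (A : Matrix (Fin N) (Fin N) (ZMod 2)) (n : Fin N)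
    (x y : Qubits N) :
    pauliN (graphStabilizer A n) x y =
      if bit ∘ y = bit ∘ x + Pi.single n 1 then
        (-1 : ℂ) ^ (∑ k, (A k n + A n k) * bit (x k)).val else 0 := by
  have h2 : ∀ a : ZMod 2, a + a = 0 := by decide
  have h : ∀ k, pauli (graphStabilizer A n k) (x k) (y k) =
      if bit (y k) = bit (x k) + (Pi.single n 1 : Fin N → ZMod 2) k then
        (-1 : ℂ) ^ ((A k n + A n k) * bit (x k)).val else 0 := by
    intro k
    -- No factor is `Y`: at `k = n` the exponent of `Z` is `A n n + A n n = 0`, and elsewhere there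
    -- is no `X`.
    refine (pauli_apply_of_mul_eq_zero _ ?_ (x k) (y k)).trans ?_
    · by_cases hk : k = n
      · subst hk; simp [graphStabilizer, h2]
      · simp [graphStabilizer, hk]
    · simp only [graphStabilizer, Pi.single_apply]
      congr
  simp only [pauliN, Matrix.of_apply, h]
  rw [Fintype.prod_ite_zero, neg_one_pow_val_sum]
  simp [funext_iff]

theorem pauliN_graphStabilizer_mulVec (A : Matrix (Fin N) (Fin N) (ZMod 2)) (n : Fin N) :
    pauliN (graphStabilizer A n) *ᵥ graphState A = graphState A := by
  funext x
  -- Row `x` has a single nonzero entry, at `x` with bit `n` flipped. Its sign is the change of the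
  -- graph form under that flip, so the two signs cancel.
  let y₀ : Qubits N := fun k => bit.symm (bit (x k) + (Pi.single n 1 : Fin N → ZMod 2) k)
  have hy₀ : bit ∘ y₀ = bit ∘ x + Pi.single n 1 := by
    funext k; simp [y₀]
  rw [Matrix.mulVec, dotProduct, Finset.sum_eq_single y₀]
  · rw [pauliN_graphStabilizer_apply, if_pos hy₀, graphState, graphState, hy₀,
      graphForm_add_single, neg_one_pow_val_add]
    simp only [Function.comp_apply]
    linear_combination ((Real.sqrt 2 : ℝ) : ℂ)⁻¹ ^ N * (-1 : ℂ) ^ (graphForm A (bit ∘ x)).val *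
      neg_one_pow_mul_self (∑ k, (A k n + A n k) * bit (x k)).val
  · intro y _ hy
    rw [pauliN_graphStabilizer_apply, if_neg, zero_mul]
    rw [← hy₀]
    exact fun h => hy (bit.injective.comp_left h)
  · simp

theorem symp_graphStabilizer (A : Matrix (Fin N) (Fin N) (ZMod 2)) (n : Fin N)
    (m : Fin N → Label) :
    symp (graphStabilizer A n) m = ∑ k, (A k n + A n k) * (m k).2 + (m n).1 := by
  simp [symp, graphStabilizer, Finset.sum_add_distrib]

/-- Powers of `Z` realize every syndrome. They therefore generate the whole stabilizer basis from
one graph state and make every decoding class nonempty. -/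
theorem symp_graphStabilizer_zLabel (A : Matrix (Fin N) (Fin N) (ZMod 2)) (n : Fin N)
    (a : Fin N → ZMod 2) : symp (graphStabilizer A n) (zLabel a) = a n := by
  simp [symp_graphStabilizer, zLabel]

/-- The symplectic product is the sum of two mirror entries of the symmetric matrix `A + Aᵀ`, hence
zero. -/
theorem commute_graphStabilizer (A : Matrix (Fin N) (Fin N) (ZMod 2)) (i j : Fin N) :
    Commute (pauliN (graphStabilizer A i)) (pauliN (graphStabilizer A j)) := by
  have h2 : ∀ a : ZMod 2, a + a = 0 := by decide
  have h : symp (graphStabilizer A i) (graphStabilizer A j) = 0 := by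
    rw [symp_graphStabilizer]
    simp only [graphStabilizer, mul_ite, mul_one, mul_zero, Finset.sum_ite_eq', Finset.mem_univ,
      if_true]
    linear_combination h2 (A i j + A j i)
  rw [Commute, SemiconjBy, pauliN_mul_comm, h]
  simp

/-- The `X` parts alone form the identity matrix. -/
theorem linearIndependent_graphStabilizer (A : Matrix (Fin N) (Fin N) (ZMod 2)) :
    LinearIndependent (ZMod 2) (graphStabilizer A) := by
  rw [Fintype.linearIndependent_iff]
  intro g hg i
  have h := congrArg Prod.snd (congrFun hg i)
  simpa [Finset.sum_apply, Prod.snd_sum, graphStabilizer] using h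

theorem pauliN_graphStabilizer_mulVec_zLabel (A : Matrix (Fin N) (Fin N) (ZMod 2))
    (a : Fin N → ZMod 2) (n : Fin N) :
    pauliN (graphStabilizer A n) *ᵥ (pauliN (zLabel a) *ᵥ graphState A) =
      (-1 : ℂ) ^ (a n).val • (pauliN (zLabel a) *ᵥ graphState A) := by
  have h := pauliN_mulVec_pauliN_mulVec (a := 0) (graphStabilizer A n) (zLabel a)
    (v := graphState A) (by simp [pauliN_graphStabilizer_mulVec])
  rwa [symp_graphStabilizer_zLabel, add_zero] at h

theorem exists_maximum_likelihood (p : Label → ℝ) (A : Matrix (Fin N) (Fin N) (ZMod 2))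
    (c : Fin N → ZMod 2) : ∃ m : Fin N → Label, (∀ n, symp (graphStabilizer A n) m = c n) ∧
      ∀ m', (∀ n, symp (graphStabilizer A n) m' = c n) → prob p m' ≤ prob p m := by
  classical
  obtain ⟨m, hm, hmax⟩ := Finset.exists_max_image
    (Finset.univ.filter fun m : Fin N → Label => ∀ n, symp (graphStabilizer A n) m = c n)
    (prob p) ⟨zLabel c, by simp [symp_graphStabilizer_zLabel]⟩
  exact ⟨m, by simpa using hm, fun m' hm' => hmax m' (by simpa using hm')⟩

theorem zLabel_zero : pauliN (zLabel (0 : Fin N → ZMod 2)) = 1 := by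
  ext x y
  have h (n : Fin N) : pauli (zLabel 0 n) = 1 := if_pos rfl
  simp only [pauliN, h, Matrix.of_apply, Matrix.one_apply]
  rw [Fintype.prod_ite_zero]
  simp [funext_iff]

/-- The one-way scheme given by the graph states of `A`. -/
def graphScheme (p : Label → ℝ) (A : Matrix (Fin N) (Fin N) (ZMod 2)) : StabilizerScheme p N where
  s := graphStabilizer A
  independent := linearIndependent_graphStabilizer A
  commute := commute_graphStabilizer A
  ψ a := pauliN (zLabel a) *ᵥ graphState A
  orthonormal a b := by
    split_ifs with h
    · rw [h, star_pauliN_mulVec_dotProduct, star_graphState_dotProduct]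
    · obtain ⟨n, hn⟩ := Function.ne_iff.mp h
      exact dotProduct_eq_zero_of_pauliN_eigen _ (pauliN_graphStabilizer_mulVec_zLabel A a n)
        (pauliN_graphStabilizer_mulVec_zLabel A b n) hn
  stabilized := pauliN_graphStabilizer_mulVec_zLabel A
  U a := pauliN (zLabel a)
  unitary a := pauliN_mem_unitaryGroup _
  corrects a m := by
    -- The phase is the commutation sign of the error with `U a`.
    refine ⟨(-1 : ℂ) ^ (symp m (zLabel a)).val, by simp, ?_⟩
    rw [zLabel_zero, Matrix.one_mulVec, Matrix.mulVec_mulVec, pauliN_mul_comm, Matrix.smul_mulVec,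
      Matrix.mulVec_mulVec]
  decode c := (exists_maximum_likelihood p A c).choose
  decode_syndrome c := (exists_maximum_likelihood p A c).choose_spec.1
  decode_max c := (exists_maximum_likelihood p A c).choose_spec.2

/-! ### The success probability of a stabilizer scheme -/

theorem bell_apply (m : Label) (i j : Fin 2) :
    bell m (i, j) = ((Real.sqrt 2 : ℝ) : ℂ)⁻¹ * pauli m j i := by
  simp [bell, bell₀, Matrix.mulVec, dotProduct, Fintype.sum_prod_type, Matrix.one_apply]
  fin_cases i <;> simp <;> ring

theorem bellN_apply (m : Fin N → Label) (x y : Qubits N) :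
    bellN m (x, y) = ((Real.sqrt 2 : ℝ) : ℂ)⁻¹ ^ N * pauliN m y x := by
  simp [bellN, bell_apply, pauliN, Finset.prod_mul_distrib]

/-- A Bell vector is a vectorized Pauli operator with Bob's index as the row, so local operators act
on it by multiplication from the two sides. -/
theorem kronecker_mulVec_bellN {a b : Type} [Fintype a] [Fintype b] (K : Matrix a (Qubits N) ℂ)
    (L : Matrix b (Qubits N) ℂ) (m : Fin N → Label) (i : a) (j : b) :
    ((K ⊗ₖ L) *ᵥ bellN m) (i, j) =
      ((Real.sqrt 2 : ℝ) : ℂ)⁻¹ ^ N * (L * pauliN m * Kᵀ) j i := by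
  simp only [Matrix.mulVec, dotProduct, Fintype.sum_prod_type, Matrix.kroneckerMap_apply,
    bellN_apply, Matrix.mul_apply, Matrix.transpose_apply, Finset.mul_sum, Finset.sum_mul]
  refine Finset.sum_congr rfl fun x _ => Finset.sum_congr rfl fun y _ => ?_
  ring

theorem inv_sqrt_two_pow_mul_self (N : ℕ) :
    ((Real.sqrt 2 : ℝ) : ℂ)⁻¹ ^ N * ((Real.sqrt 2 : ℝ) : ℂ)⁻¹ ^ N = (2 ^ N)⁻¹ := by
  rw [← mul_pow, inv_sqrt_two_mul_self, inv_pow]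

/-- After Alice's outcome `star v`, Bob's half of `bellN m` is in the state `pauliN m *ᵥ v`. -/
theorem bellN_dotProduct_proj_kronecker (m : Fin N → Label) (v : Qubits N → ℂ)
    (F : Matrix (Qubits N) (Qubits N) ℂ) :
    star (bellN m) ⬝ᵥ ((proj (star v) ⊗ₖ F) *ᵥ bellN m) =
      (2 ^ N)⁻¹ * (star (pauliN m *ᵥ v) ⬝ᵥ (F *ᵥ (pauliN m *ᵥ v))) := by
  have h (x y : Qubits N) : ((proj (star v) ⊗ₖ F) *ᵥ bellN m) (x, y) =
      ((Real.sqrt 2 : ℝ) : ℂ)⁻¹ ^ N * (star (v x) * (F *ᵥ (pauliN m *ᵥ v)) y) := by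
    have ht : (proj (star v))ᵀ = proj v := by
      ext; simp [proj, Matrix.vecMulVec_apply, mul_comm]
    rw [kronecker_mulVec_bellN, ht, proj, Matrix.mul_vecMulVec, Matrix.vecMulVec_apply,
      Matrix.mulVec_mulVec, Pi.star_apply]
    ring
  have hc : star (((Real.sqrt 2 : ℝ) : ℂ)⁻¹) = ((Real.sqrt 2 : ℝ) : ℂ)⁻¹ := by
    rw [star_inv₀, Complex.star_def, Complex.conj_ofReal]
  rw [← inv_sqrt_two_pow_mul_self]
  simp only [dotProduct, Fintype.sum_prod_type, h, Pi.star_apply, bellN_apply, star_mul', star_pow,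
    hc]
  rw [Finset.sum_comm]
  generalize F *ᵥ (pauliN m *ᵥ v) = u
  simp only [Matrix.mulVec, dotProduct, star_sum, star_mul', Finset.mul_sum, Finset.sum_mul]
  refine Finset.sum_congr rfl fun y _ => Finset.sum_congr rfl fun x _ => ?_
  ring

theorem dotProduct_proj_mulVec {n : Type} [Fintype n] (v w : n → ℂ) :
    star w ⬝ᵥ (proj v *ᵥ w) = star (star v ⬝ᵥ w) * (star v ⬝ᵥ w) := by
  rw [proj, Matrix.vecMulVec_mulVec, dotProduct_smul, op_smul_eq_mul, Matrix.star_dotProduct w v]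

/-- The matrix with columns `v a` is an isometry between spaces of equal dimension, hence also a
coisometry. -/
theorem sum_proj_eq_one {ι n : Type} [Fintype ι] [Fintype n] [DecidableEq ι] [DecidableEq n]
    (v : ι → n → ℂ) (hv : ∀ a b, star (v a) ⬝ᵥ v b = if a = b then 1 else 0)
    (hcard : Fintype.card ι = Fintype.card n) : ∑ a, proj (v a) = 1 := by
  have h : (Matrix.of fun i a => v a i)ᴴ * (Matrix.of fun i a => v a i) = 1 := by
    ext a b
    rw [Matrix.one_apply, ← hv]
    simp [Matrix.mul_apply, dotProduct]
  rw [Matrix.mul_eq_one_comm_of_card_eq _ _ _ hcard] at h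
  rw [← h]
  ext i j
  simp [Matrix.sum_apply, Matrix.mul_apply, proj, Matrix.vecMulVec_apply]

namespace StabilizerScheme

variable {p : Label → ℝ} (S : StabilizerScheme p N)

/-- The syndrome of an error. -/
def syndrome (m : Fin N → Label) : Fin N → ZMod 2 := fun n => symp (S.s n) m

theorem sum_proj : ∑ c, proj (S.ψ c) = 1 :=
  sum_proj_eq_one S.ψ S.orthonormal (by simp [ZMod.card])

theorem isPOVM_alice : IsPOVM S.alice := by
  refine ⟨fun a => proj_posSemidef _, sum_proj_eq_one _ (fun a b => ?_) (by simp [ZMod.card])⟩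
  rw [Matrix.star_dotProduct_star, dotProduct_comm, S.orthonormal]
  split_ifs <;> simp_all

theorem isPOVM_syndromeDecoding : IsPOVM S.syndromeDecoding := by
  refine ⟨fun m => Matrix.posSemidef_sum _ fun c _ => ?_, ?_⟩
  · split_ifs
    · exact proj_posSemidef _
    · exact Matrix.PosSemidef.zero
  · simp only [syndromeDecoding]
    rw [Finset.sum_comm]
    simp [S.sum_proj]

theorem isPOVM_bob (a : Fin N → ZMod 2) : IsPOVM (S.bob a) := by
  refine ⟨fun m => (S.isPOVM_syndromeDecoding.1 m).mul_mul_conjTranspose_same _, ?_⟩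
  simp only [bob]
  rw [← Finset.sum_mul, ← Finset.mul_sum, S.isPOVM_syndromeDecoding.2, mul_one]
  exact Matrix.mem_unitaryGroup_iff.mp (S.unitary a)

theorem star_ψ_dotProduct_pauliN (m : Fin N → Label) {c : Fin N → ZMod 2}
    (hc : c ≠ S.syndrome m) : star (S.ψ c) ⬝ᵥ (pauliN m *ᵥ S.ψ 0) = 0 := by
  obtain ⟨n, hn⟩ := Function.ne_iff.mp hc
  refine dotProduct_eq_zero_of_pauliN_eigen _ (S.stabilized c n)
    (pauliN_mulVec_pauliN_mulVec _ m (S.stabilized 0 n)) ?_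
  simpa [syndrome] using hn

/-- Bob's measurement yields the syndrome with certainty. -/
theorem dotProduct_proj_syndrome (m : Fin N → Label) (c : Fin N → ZMod 2) :
    star (pauliN m *ᵥ S.ψ 0) ⬝ᵥ (proj (S.ψ c) *ᵥ (pauliN m *ᵥ S.ψ 0)) =
      if c = S.syndrome m then 1 else 0 := by
  have h0 : ∀ c, c ≠ S.syndrome m →
      star (pauliN m *ᵥ S.ψ 0) ⬝ᵥ (proj (S.ψ c) *ᵥ (pauliN m *ᵥ S.ψ 0)) = 0 := by
    intro c hc
    rw [dotProduct_proj_mulVec, S.star_ψ_dotProduct_pauliN m hc, mul_zero]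
  split_ifs with hc
  -- By completeness of the basis the outcome probabilities sum to 1, and all but one of them
  -- vanish.
  · have h : star (pauliN m *ᵥ S.ψ 0) ⬝ᵥ ((∑ c, proj (S.ψ c)) *ᵥ (pauliN m *ᵥ S.ψ 0)) = 1 := by
      rw [S.sum_proj, Matrix.one_mulVec, star_pauliN_mulVec_dotProduct, S.orthonormal, if_pos rfl]
    rw [Matrix.sum_mulVec, dotProduct_sum, Finset.sum_eq_single c] at h
    · exact h
    · intro b _ hb
      exact h0 b (hc ▸ hb)
    · simp
  · exact h0 c hc

/-- Undoing `U a` leaves `pauliN m *ᵥ S.ψ 0` up to a phase, which the quadratic form does not see,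
so Bob's answer is deterministic and independent of `a`. -/
theorem dotProduct_bob (a : Fin N → ZMod 2) (m m' : Fin N → Label) :
    star (pauliN m *ᵥ S.ψ a) ⬝ᵥ (S.bob a m' *ᵥ (pauliN m *ᵥ S.ψ a)) =
      if S.decode (S.syndrome m) = m' then 1 else 0 := by
  obtain ⟨c, hc, h⟩ := S.corrects a m
  have hU : (S.U a)ᴴ * S.U a = 1 := Matrix.mem_unitaryGroup_iff'.mp (S.unitary a)
  have hUv : (S.U a)ᴴ *ᵥ (pauliN m *ᵥ S.ψ a) = c • (pauliN m *ᵥ S.ψ 0) := by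
    rw [h, Matrix.mulVec_smul, Matrix.mulVec_mulVec, hU, Matrix.one_mulVec]
  have hcc : star c * c = 1 := by
    rw [Complex.star_def, Complex.conj_mul', hc]; simp
  rw [bob, ← Matrix.mulVec_mulVec, ← Matrix.mulVec_mulVec, hUv,
    ← Matrix.conjTranspose_conjTranspose (S.U a), ← star_mulVec_dotProduct,
    hUv, star_smul, Matrix.mulVec_smul, smul_dotProduct,
    dotProduct_smul, smul_smul, hcc, one_smul, syndromeDecoding, Matrix.sum_mulVec,
    dotProduct_sum, Finset.sum_eq_single (S.syndrome m)]
  · split_ifs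
    · rw [S.dotProduct_proj_syndrome, if_pos rfl]
    · simp
  · intro b _ hb
    split_ifs
    · rw [S.dotProduct_proj_syndrome, if_neg hb]
    · simp
  · simp

/-- The scheme succeeds if and only if the error is the most likely one with its syndrome. -/
theorem successProb_eq :
    successProb p (oneWayPOVM S.alice S.bob) =
      ∑ m, if S.decode (S.syndrome m) = m then prob p m else 0 := by
  refine Finset.sum_congr rfl fun m _ => ?_
  have h : star (bellN m) ⬝ᵥ (oneWayPOVM S.alice S.bob m *ᵥ bellN m) =
      if S.decode (S.syndrome m) = m then 1 else 0 := by
    rw [oneWayPOVM, Matrix.sum_mulVec, dotProduct_sum]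
    simp only [alice, bellN_dotProduct_proj_kronecker, dotProduct_bob, Finset.sum_const,
      Finset.card_univ, Fintype.card_pi, ZMod.card, Finset.prod_const, Fintype.card_fin,
      nsmul_eq_mul]
    -- Each of Alice's `2 ^ N` outcomes contributes the same amount, with weight `2 ^ (-N)`.
    push_cast
    rw [← mul_assoc, mul_inv_cancel₀ (by positivity), one_mul]
  rw [h]
  split_ifs <;> simp

end StabilizerScheme

/-! ### Random graph states -/

/-- The additive map `A ↦ (A + Aᵀ) x`, restricted to the coordinates other than `i`, is onto, so its
fibres have equal size. One coordinate must be dropped because `A + Aᵀ` is alternating, so that `x`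
is orthogonal to `(A + Aᵀ) x`; this is the origin of the factor 2. -/
theorem card_matrix_mulVec_eq (x : Fin N → ZMod 2) (i : Fin N) (hx : x i = 1)
    (w : {n // n ≠ i} → ZMod 2) :
    2 ^ N * (Finset.univ.filter fun A : Matrix (Fin N) (Fin N) (ZMod 2) =>
      (fun n : {n // n ≠ i} => ∑ k, (A k n + A n k) * x k) = w).card =
    2 * Fintype.card (Matrix (Fin N) (Fin N) (ZMod 2)) := by
  let φ : Matrix (Fin N) (Fin N) (ZMod 2) →+ ({n // n ≠ i} → ZMod 2) :=
    { toFun := fun A n => ∑ k, (A k n + A n k) * x k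
      map_zero' := by ext; simp
      map_add' := by
        intro A B
        ext n
        simp only [Matrix.add_apply, Pi.add_apply, ← Finset.sum_add_distrib]
        refine Finset.sum_congr rfl fun k _ => ?_
        ring }
  have hφ : Function.Surjective φ := by
    intro v
    -- Only row `i` is nonzero, and there `x i = 1`.
    refine ⟨Matrix.of fun k n => if h : n ≠ i then if k = i then v ⟨n, h⟩ else 0 else 0, ?_⟩
    ext ⟨n, hn⟩
    change ∑ k, (_ + _) * x k = _
    simp [hn, hx]
  have hfib : ∀ v, (Finset.univ.filter fun A => φ A = v).card =
      (Finset.univ.filter fun A => φ A = w).card := fun v =>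
    AddMonoidHom.card_fiber_eq_of_mem_range φ (hφ v) (hφ w)
  have hsum := Finset.card_eq_sum_card_fiberwise (f := φ) (s := Finset.univ)
    (t := Finset.univ) (by simp)
  simp only [hfib, Finset.sum_const, Finset.card_univ, smul_eq_mul] at hsum
  have hcard : 2 * Fintype.card ({n // n ≠ i} → ZMod 2) = 2 ^ N := by
    obtain ⟨M, rfl⟩ : ∃ M, N = M + 1 := ⟨N - 1, by have := i.pos; omega⟩
    rw [Fintype.card_fun, ZMod.card, Fintype.card_subtype_compl]
    simp [pow_succ, mul_comm]
  rw [hsum, ← hcard, mul_assoc]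
  rfl

/-- Two different errors have the same syndrome for a small fraction of the graph states. -/
theorem card_symp_graphStabilizer_eq_le {m m' : Fin N → Label} (h : m ≠ m') :
    2 ^ N * (Finset.univ.filter fun A : Matrix (Fin N) (Fin N) (ZMod 2) =>
      ∀ n, symp (graphStabilizer A n) m' = symp (graphStabilizer A n) m).card ≤
    2 * Fintype.card (Matrix (Fin N) (Fin N) (ZMod 2)) := by
  have h01 : ∀ a : ZMod 2, a ≠ 0 → a = 1 := by decide
  -- If the `X` parts agree, equal syndromes force equal `Z` parts, so no `A` confuses the two
  -- errors. Otherwise their difference supplies the nonzero vector `x`.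
  by_cases hx : ∀ i, (m i).2 = (m' i).2
  · rw [Finset.filter_false_of_mem, Finset.card_empty]
    · simp
    · intro A _ hA
      refine h (funext fun n => Prod.ext ?_ (hx n))
      have := hA n
      simp only [symp_graphStabilizer, hx, add_right_inj] at this
      exact this.symm
  · push Not at hx
    obtain ⟨i, hi⟩ := hx
    have hi1 : (m i).2 - (m' i).2 = 1 := h01 _ (sub_ne_zero.mpr hi)
    rw [← card_matrix_mulVec_eq (fun k => (m k).2 - (m' k).2) i hi1
      (fun n => (m' n).1 - (m n).1)]
    refine Nat.mul_le_mul_left _ (Finset.card_le_card ?_)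
    intro A hA
    simp only [Finset.mem_filter, Finset.mem_univ, true_and, symp_graphStabilizer] at hA ⊢
    funext n
    simp only [mul_sub, Finset.sum_sub_distrib]
    linear_combination -hA n

/-! ### Probabilities of errors and the random-coding bound. -/

theorem prob_nonneg {p : Label → ℝ} (hp : p ∈ stdSimplex ℝ Label) (m : Fin N → Label) :
    0 ≤ prob p m := Finset.prod_nonneg fun _ _ => hp.1 _

theorem sum_prob_rpow {p : Label → ℝ} (hp : p ∈ stdSimplex ℝ Label) (t : ℝ) (N : ℕ) :
    ∑ m : Fin N → Label, prob p m ^ t = (∑ a, p a ^ t) ^ N := by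
  have h : ∀ m : Fin N → Label, prob p m ^ t = ∏ n, p (m n) ^ t := fun m =>
    (Real.finsetProd_rpow _ _ (fun n _ => hp.1 _) _).symm
  simp only [h]
  rw [Fintype.sum_pow]

theorem sum_prob {p : Label → ℝ} (hp : p ∈ stdSimplex ℝ Label) (N : ℕ) :
    ∑ m : Fin N → Label, prob p m = 1 := by
  have h := sum_prob_rpow hp 1 N
  simpa [hp.2] using h

theorem card_prob_le_mul_prob_le_one {p : Label → ℝ} (hp : p ∈ stdSimplex ℝ Label)
    (m : Fin N → Label) :
    ((Finset.univ.filter fun m' : Fin N → Label => prob p m ≤ prob p m').card : ℝ) * prob p m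
      ≤ 1 := by
  rw [← sum_prob hp N, ← nsmul_eq_mul]
  refine (Finset.card_nsmul_le_sum _ (prob p) _ fun m' hm' => (Finset.mem_filter.mp hm').2).trans ?_
  exact Finset.sum_le_sum_of_subset_of_nonneg (Finset.subset_univ _)
    fun m' _ _ => prob_nonneg hp m'

open Classical in
/-- The number of graph states for which the error `m` is not corrected. -/
theorem card_decode_ne_le (p : Label → ℝ) (m : Fin N → Label) :
    2 ^ N * (Finset.univ.filter fun A : Matrix (Fin N) (Fin N) (ZMod 2) =>
      (graphScheme p A).decode ((graphScheme p A).syndrome m) ≠ m).card ≤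
    (Finset.univ.filter fun m' : Fin N → Label => prob p m ≤ prob p m').card *
      (2 * Fintype.card (Matrix (Fin N) (Fin N) (ZMod 2))) := by
  have hsub : (Finset.univ.filter fun A : Matrix (Fin N) (Fin N) (ZMod 2) =>
      (graphScheme p A).decode ((graphScheme p A).syndrome m) ≠ m) ⊆
      ((Finset.univ.filter fun m' : Fin N → Label => prob p m ≤ prob p m').erase m).biUnion
        fun m' => Finset.univ.filter fun A : Matrix (Fin N) (Fin N) (ZMod 2) =>
          ∀ n, symp (graphStabilizer A n) m' = symp (graphStabilizer A n) m := by
    intro A hA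
    simp only [Finset.mem_filter, Finset.mem_univ, true_and, Finset.mem_biUnion,
      Finset.mem_erase] at hA ⊢
    -- A wrong guess has the syndrome of `m` and is at least as likely; the union bound runs over
    -- such rivals.
    exact ⟨_, ⟨hA, (graphScheme p A).decode_max _ m fun n => rfl⟩,
      (graphScheme p A).decode_syndrome _⟩
  refine (Nat.mul_le_mul_left _ ((Finset.card_le_card hsub).trans Finset.card_biUnion_le)).trans ?_
  rw [Finset.mul_sum, ← smul_eq_mul (Finset.card _)]
  refine (Finset.sum_le_card_nsmul _ _ _ fun m' hm' => ?_).trans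
    (nsmul_le_nsmul_left (Nat.zero_le _) (Finset.card_le_card (Finset.erase_subset _ _)))
  exact card_symp_graphStabilizer_eq_le (Finset.ne_of_mem_erase hm').symm

/-- Since `min 1 x ≤ x ^ s`, the union bound turns into a power of `q`, whose sum over errors
factorizes over the qubit pairs. -/
theorem mul_min_le_rpow {q δ s : ℝ} (hq : 0 < q) (hδ : 0 < δ) (hs : 0 ≤ s) (hs1 : s ≤ 1) :
    q * min 1 (δ / q) ≤ δ ^ s * q ^ (1 - s) := by
  have hx : 0 < δ / q := div_pos hδ hq
  have h : min 1 (δ / q) ≤ (δ / q) ^ s := by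
    rcases le_total 1 (δ / q) with h1 | h1
    · exact (min_le_left _ _).trans (Real.one_le_rpow h1 hs)
    · exact (min_le_right _ _).trans (Real.self_le_rpow_of_le_one hx.le h1 hs1)
  refine (mul_le_mul_of_nonneg_left h hq.le).trans (le_of_eq ?_)
  rw [Real.div_rpow hδ.le hq.le, Real.rpow_sub hq, Real.rpow_one]
  ring

open Classical in
/-- The average failure probability of a random graph state. -/
theorem prob_mul_card_decode_ne_le {p : Label → ℝ} (hp : p ∈ stdSimplex ℝ Label)
    (m : Fin N → Label) {s : ℝ} (hs : 0 ≤ s) (hs1 : s ≤ 1) :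
    prob p m * (Finset.univ.filter fun A : Matrix (Fin N) (Fin N) (ZMod 2) =>
      (graphScheme p A).decode ((graphScheme p A).syndrome m) ≠ m).card ≤
    Fintype.card (Matrix (Fin N) (Fin N) (ZMod 2)) * ((2 / 2 ^ N) ^ s * prob p m ^ (1 - s)) := by
  set K : ℝ := (Fintype.card (Matrix (Fin N) (Fin N) (ZMod 2)) : ℝ)
  set e : ℝ := ((Finset.univ.filter fun A : Matrix (Fin N) (Fin N) (ZMod 2) =>
      (graphScheme p A).decode ((graphScheme p A).syndrome m) ≠ m).card : ℝ)
  set L : ℝ := ((Finset.univ.filter fun m' : Fin N → Label => prob p m ≤ prob p m').card : ℝ)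
  have hK : 0 ≤ K := Nat.cast_nonneg _
  have h1 : e ≤ K := Nat.cast_le.mpr (Finset.card_le_univ _)
  have h2 : 2 ^ N * e ≤ L * (2 * K) := by
    have h := (Nat.cast_le (α := ℝ)).mpr (card_decode_ne_le p m)
    push_cast at h
    exact h
  have h3 : L * prob p m ≤ 1 := card_prob_le_mul_prob_le_one hp m
  rcases (prob_nonneg hp m).eq_or_lt with h0 | h0
  · rw [← h0, zero_mul]; positivity
  · refine le_trans ?_ (mul_le_mul_of_nonneg_left (mul_min_le_rpow h0 (by positivity) hs hs1) hK)
    rw [mul_left_comm]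
    refine mul_le_mul_of_nonneg_left ?_ h0.le
    rw [mul_min_of_nonneg _ _ hK, mul_one]
    refine le_min h1 ?_
    rw [div_div, mul_div_assoc', le_div_iff₀ (by positivity)]
    calc e * (2 ^ N * prob p m) = 2 ^ N * e * prob p m := by ring
      _ ≤ L * (2 * K) * prob p m := mul_le_mul_of_nonneg_right h2 h0.le
      _ = (L * prob p m) * (K * 2) := by ring
      _ ≤ 1 * (K * 2) := mul_le_mul_of_nonneg_right h3 (by positivity)
      _ = K * 2 := one_mul _

/-- Some matrix `A` fails no more often than the average over all of them. -/
theorem exists_successProb_ge {p : Label → ℝ} (hp : p ∈ stdSimplex ℝ Label) (N : ℕ) {s : ℝ}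
    (hs : 0 ≤ s) (hs1 : s ≤ 1) : ∃ S : StabilizerScheme p N,
      1 - 2 ^ s * (2 ^ (-s) * ∑ a, p a ^ (1 - s)) ^ N ≤
        successProb p (oneWayPOVM S.alice S.bob) := by
  classical
  let fail (A : Matrix (Fin N) (Fin N) (ZMod 2)) : ℝ :=
    ∑ m, if (graphScheme p A).decode ((graphScheme p A).syndrome m) ≠ m then prob p m else 0
  have hfail (A) : successProb p (oneWayPOVM (graphScheme p A).alice (graphScheme p A).bob) =
      1 - fail A := by
    rw [StabilizerScheme.successProb_eq, eq_sub_iff_add_eq, ← sum_prob hp N,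
      ← Finset.sum_add_distrib]
    refine Finset.sum_congr rfl fun m _ => ?_
    by_cases h : (graphScheme p A).decode ((graphScheme p A).syndrome m) = m <;> simp [h]
  have hr : ((2 : ℝ) / 2 ^ N) ^ s * ∑ m : Fin N → Label, prob p m ^ (1 - s) =
      2 ^ s * (2 ^ (-s) * ∑ a, p a ^ (1 - s)) ^ N := by
    rw [sum_prob_rpow hp, mul_pow, Real.div_rpow (by norm_num) (by positivity),
      Real.rpow_neg (by norm_num), inv_pow, ← Real.rpow_natCast_mul (by norm_num),
      ← Real.rpow_mul_natCast (by norm_num), mul_comm (N : ℝ) s]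
    ring
  have havg : ∑ A, fail A ≤ ∑ _A : Matrix (Fin N) (Fin N) (ZMod 2),
      2 ^ s * (2 ^ (-s) * ∑ a, p a ^ (1 - s)) ^ N := by
    simp only [fail]
    rw [Finset.sum_comm, Finset.sum_const, Finset.card_univ, nsmul_eq_mul, ← hr, Finset.mul_sum,
      Finset.mul_sum]
    refine Finset.sum_le_sum fun m _ => ?_
    rw [← Finset.sum_filter, Finset.sum_const, nsmul_eq_mul, mul_comm]
    exact prob_mul_card_decode_ne_le hp m hs hs1
  obtain ⟨A, -, hA⟩ := Finset.exists_le_of_sum_le Finset.univ_nonempty havg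
  exact ⟨graphScheme p A, by rw [hfail]; linarith⟩

/-- The random-coding exponent is positive for entropy less than one. -/
theorem exists_rpow_sum_lt_one {p : Label → ℝ} (hp : p ∈ stdSimplex ℝ Label)
    (hH : entropy p < 1) :
    ∃ s : ℝ, 0 ≤ s ∧ s ≤ 1 ∧ 2 ^ (-s) * ∑ a, p a ^ (1 - s) < 1 := by
  -- The exponential form is differentiable at 0 even with zero entries of `p`, whose terms vanish
  -- identically.
  let g : ℝ → ℝ := fun s => Real.exp (s * -Real.log 2) * ∑ a, p a * Real.exp (s * -Real.log (p a))
  have hexp (c : ℝ) : HasDerivAt (fun s : ℝ => Real.exp (s * c)) c 0 := by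
    simpa using ((hasDerivAt_id (0 : ℝ)).mul_const c).exp
  have hg : HasDerivAt g (-Real.log 2 + ∑ a, p a * -Real.log (p a)) 0 := by
    have h := (hexp (-Real.log 2)).mul (HasDerivAt.fun_sum (u := Finset.univ)
      fun a _ => (hexp (-Real.log (p a))).const_mul (p a))
    simp only [zero_mul, Real.exp_zero, mul_one, one_mul, hp.2] at h
    exact h
  have hg0 : g 0 = 1 := by simp [g, hp.2]
  have hneg : -Real.log 2 + ∑ a, p a * -Real.log (p a) < 0 := by
    have h2 : 0 < Real.log 2 := Real.log_pos (by norm_num)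
    have h : ∑ a, p a * -Real.log (p a) = entropy p * Real.log 2 := by
      rw [entropy, ← Finset.sum_neg_distrib, Finset.sum_mul]
      refine Finset.sum_congr rfl fun a _ => ?_
      rw [Real.logb]
      field_simp
    rw [h]
    nlinarith
  have hslope := (hg.tendsto_slope.mono_left
    (nhdsWithin_mono (0 : ℝ) (fun x (hx : x ∈ Set.Ioi (0 : ℝ)) => (Set.mem_Ioi.mp hx).ne'))).eventually_lt_const hneg
  have hlt : ∀ᶠ s : ℝ in nhdsWithin 0 (Set.Ioi 0), s < 1 :=
    nhdsWithin_le_nhds (eventually_lt_nhds one_pos)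
  obtain ⟨s, hs, hs1, hs0⟩ := (hslope.and (hlt.and self_mem_nhdsWithin)).exists
  have hs0 : 0 < s := hs0
  refine ⟨s, hs0.le, hs1.le, ?_⟩
  have hgs : g s < 1 := by
    rw [slope_def_field, hg0, sub_zero, div_neg_iff] at hs
    rcases hs with h | h <;> linarith
  refine lt_of_le_of_lt (le_of_eq ?_) hgs
  simp only [g]
  congr 1
  · rw [Real.rpow_def_of_pos (by norm_num)]; ring_nf
  · refine Finset.sum_congr rfl fun a _ => ?_
    rcases (hp.1 a).eq_or_lt with h | h
    -- This needs `s < 1` strictly, since `0 ^ 0 = 1`.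
    · rw [← h, Real.zero_rpow (by linarith), zero_mul]
    · rw [Real.rpow_def_of_pos h, mul_sub, mul_one, Real.exp_sub, Real.exp_log h, mul_neg,
        Real.exp_neg, mul_comm s]
      rfl

/-! ### The structure of LOCC protocols -/

theorem krausMap_apply {ι m n : Type} [Fintype ι] [Fintype n] (K : ι → Matrix m n ℂ)
    (ρ : Matrix n n ℂ) : krausMap K ρ = ∑ j, K j * ρ * (K j)ᴴ := rfl

theorem trace_krausMap {ι m n : Type} [Fintype ι] [Fintype n] [Fintype m] (K : ι → Matrix m n ℂ)
    (ρ : Matrix n n ℂ) : (krausMap K ρ).trace = ((∑ j, (K j)ᴴ * K j) * ρ).trace := by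
  rw [krausMap_apply, Matrix.trace_sum, Finset.sum_mul, Matrix.trace_sum]
  refine Finset.sum_congr rfl fun j _ => ?_
  rw [Matrix.trace_mul_comm, Matrix.mul_assoc]

theorem sum_kronecker {ι l m n o : Type} (s : Finset ι) (K : ι → Matrix l m ℂ)
    (L : Matrix n o ℂ) : (∑ i ∈ s, K i) ⊗ₖ L = ∑ i ∈ s, K i ⊗ₖ L := by
  ext
  simp [Matrix.sum_apply, Finset.sum_mul]

theorem kronecker_sum {ι l m n o : Type} (s : Finset ι) (K : Matrix l m ℂ)
    (L : ι → Matrix n o ℂ) : K ⊗ₖ (∑ i ∈ s, L i) = ∑ i ∈ s, K ⊗ₖ L i := by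
  ext
  simp [Matrix.sum_apply, Finset.mul_sum]

namespace IsLOCC

variable {A B A' B' O : Type} [DecidableEq O]
  {J : O → Matrix (A × B) (A × B) ℂ →ₗ[ℂ] Matrix (A' × B') (A' × B') ℂ}

/-- The operations of an LOCC protocol have Kraus operators of product form. -/
theorem exists_kraus (h : IsLOCC A B J) : ∀ [Fintype A] [Fintype B] (o : O),
    ∃ (ι : Type) (_ : Fintype ι) (a : ι → Matrix A' A ℂ) (b : ι → Matrix B' B ℂ),
      J o = krausMap fun i => a i ⊗ₖ b i := by
  classical
  induction h with
  | halt o =>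
    intro _ _ o'
    by_cases ho : o' = o
    · refine ⟨Unit, inferInstance, fun _ => 1, fun _ => 1, ?_⟩
      ext1 ρ
      simp [krausMap_apply, ho]
    · refine ⟨Empty, inferInstance, fun _ => 1, fun _ => 1, ?_⟩
      ext1 ρ
      simp [krausMap_apply, ho]
  | @alice A B A₁ iA _ iB _ _ _ r s K hK J hJ ih =>
    intro jA jB o
    obtain rfl : jA = iA := Subsingleton.elim _ _
    obtain rfl : jB = iB := Subsingleton.elim _ _
    choose ι hι a b hab using fun k => ih k o
    refine ⟨Σ k, ι k × Fin s, inferInstance, fun i => a i.1 i.2.1 * K i.1 i.2.2,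
      fun i => b i.1 i.2.1, ?_⟩
    ext1 ρ
    simp only [LinearMap.sum_apply, LinearMap.comp_apply, hab, krausMap_apply,
      Fintype.sum_sigma, Fintype.sum_prod_type, Matrix.mul_sum, Matrix.sum_mul]
    refine Finset.sum_congr rfl fun k _ => Finset.sum_congr rfl fun i _ =>
      Finset.sum_congr rfl fun j _ => ?_
    have hm : (a k i * K k j) ⊗ₖ b k i = (a k i ⊗ₖ b k i) * (K k j ⊗ₖ (1 : Matrix B B ℂ)) := by
      rw [← Matrix.mul_kronecker_mul, Matrix.mul_one]
    rw [hm, Matrix.conjTranspose_mul]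
    simp only [Matrix.mul_assoc]
  | @bob A B B₁ iA _ iB _ _ _ r s K hK J hJ ih =>
    intro jA jB o
    obtain rfl : jA = iA := Subsingleton.elim _ _
    obtain rfl : jB = iB := Subsingleton.elim _ _
    choose ι hι a b hab using fun k => ih k o
    refine ⟨Σ k, ι k × Fin s, inferInstance, fun i => a i.1 i.2.1,
      fun i => b i.1 i.2.1 * K i.1 i.2.2, ?_⟩
    ext1 ρ
    simp only [LinearMap.sum_apply, LinearMap.comp_apply, hab, krausMap_apply,
      Fintype.sum_sigma, Fintype.sum_prod_type, Matrix.mul_sum, Matrix.sum_mul]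
    refine Finset.sum_congr rfl fun k _ => Finset.sum_congr rfl fun i _ =>
      Finset.sum_congr rfl fun j _ => ?_
    have hm : a k i ⊗ₖ (b k i * K k j) = (a k i ⊗ₖ b k i) * ((1 : Matrix A A ℂ) ⊗ₖ K k j) := by
      rw [← Matrix.mul_kronecker_mul, Matrix.mul_one]
    rw [hm, Matrix.conjTranspose_mul]
    simp only [Matrix.mul_assoc]

theorem posSemidef (h : IsLOCC A B J) [Fintype A] [Fintype B] [Fintype A'] [Fintype B'] (o : O)
    {ρ : Matrix (A × B) (A × B) ℂ} (hρ : ρ.PosSemidef) : (J o ρ).PosSemidef := by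
  obtain ⟨ι, _, a, b, hab⟩ := h.exists_kraus o
  rw [hab, krausMap_apply]
  exact Matrix.posSemidef_sum _ fun i _ => hρ.mul_mul_conjTranspose_same _

/-- The effect of a record is the sum of `Kᴴ * K` over its Kraus operators. -/
theorem exists_povm (h : IsLOCC A B J) [Fintype A] [Fintype B] [Fintype A'] [Fintype B'] :
    ∃ M : O → Matrix (A × B) (A × B) ℂ, ∀ o ρ, (J o ρ).trace = (M o * ρ).trace := by
  choose ι hι a b hab using fun o => h.exists_kraus o
  exact ⟨fun o => ∑ i, (a o i ⊗ₖ b o i)ᴴ * (a o i ⊗ₖ b o i), fun o ρ => by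
    rw [hab, trace_krausMap]⟩

/-- Every round preserves the total trace by its completeness relation, and a halt puts everything
on one record. -/
theorem sum_trace [Fintype A'] [Fintype B'] [Fintype O] (h : IsLOCC A B J) :
    ∀ [Fintype A] [Fintype B] (ρ : Matrix (A × B) (A × B) ℂ), ∑ o, (J o ρ).trace = ρ.trace := by
  induction h with
  | halt o =>
    intro jA jB ρ
    rw [Finset.sum_eq_single o]
    · simp only [if_true, LinearMap.id_apply]
      congr!
    · intro b _ hb
      simp [hb]
    · simp
  | @alice A B A₁ iA _ iB _ _ _ r s K hK J hJ ih =>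
    intro jA jB ρ
    obtain rfl : jA = iA := Subsingleton.elim _ _
    obtain rfl : jB = iB := Subsingleton.elim _ _
    simp only [LinearMap.sum_apply, LinearMap.comp_apply, Matrix.trace_sum]
    rw [Finset.sum_comm]
    simp only [ih, trace_krausMap]
    rw [← Matrix.trace_sum, ← Finset.sum_mul]
    simp only [Matrix.conjTranspose_kronecker, Matrix.conjTranspose_one,
      ← Matrix.mul_kronecker_mul, Matrix.one_mul, ← sum_kronecker]
    rw [hK, Matrix.one_kronecker_one, Matrix.one_mul]
  | @bob A B B₁ iA _ iB _ _ _ r s K hK J hJ ih =>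
    intro jA jB ρ
    obtain rfl : jA = iA := Subsingleton.elim _ _
    obtain rfl : jB = iB := Subsingleton.elim _ _
    simp only [LinearMap.sum_apply, LinearMap.comp_apply, Matrix.trace_sum]
    rw [Finset.sum_comm]
    simp only [ih, trace_krausMap]
    rw [← Matrix.trace_sum, ← Finset.sum_mul]
    simp only [Matrix.conjTranspose_kronecker, Matrix.conjTranspose_one,
      ← Matrix.mul_kronecker_mul, Matrix.one_mul, ← kronecker_sum]
    rw [hK, Matrix.one_kronecker_one, Matrix.one_mul]

/-- Protocols can be run one after the other. -/
theorem bind {A'' B'' O' : Type} [DecidableEq O'] [Fintype O] (h : IsLOCC A B J)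
    (J' : O → O' → Matrix (A' × B') (A' × B') ℂ →ₗ[ℂ] Matrix (A'' × B'') (A'' × B'') ℂ)
    (hJ' : ∀ o, IsLOCC A' B' (J' o)) :
    IsLOCC A B (fun o' => ∑ o, (J' o o').comp (J o)) := by
  induction h with
  | halt o =>
    convert hJ' o using 1
    funext o'
    rw [Finset.sum_eq_single o]
    · simp
    · intro b _ hb
      simp [hb]
    · simp
  | alice K hK J hJ ih =>
    convert IsLOCC.alice K hK _ ih using 1
    funext o'
    ext1 ρ
    simp only [LinearMap.sum_apply, LinearMap.comp_apply, map_sum]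
    rw [Finset.sum_comm]
  | bob K hK J hJ ih =>
    convert IsLOCC.bob K hK _ ih using 1
    funext o'
    ext1 ρ
    simp only [LinearMap.sum_apply, LinearMap.comp_apply, map_sum]
    rw [Finset.sum_comm]

variable [Fintype A] [DecidableEq A] [Fintype B] [DecidableEq B] {C κ ι : Type} [Fintype C]
  [DecidableEq C] [Fintype κ] [Fintype ι]

theorem alice_fintype (K : κ → ι → Matrix C A ℂ) (hK : ∑ k, ∑ j, (K k j)ᴴ * K k j = 1)
    (J : κ → O → Matrix (C × B) (C × B) ℂ →ₗ[ℂ] Matrix (A' × B') (A' × B') ℂ)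
    (hJ : ∀ k, IsLOCC C B (J k)) :
    IsLOCC A B (fun o => ∑ k, (J k o).comp (krausMap fun j => K k j ⊗ₖ (1 : Matrix B B ℂ))) := by
  convert IsLOCC.alice (fun k j => K ((Fintype.equivFin κ).symm k) ((Fintype.equivFin ι).symm j))
    ?_ (fun k => J ((Fintype.equivFin κ).symm k)) (fun k => hJ _) using 1
  · funext o
    rw [← (Fintype.equivFin κ).symm.sum_comp]
    refine Finset.sum_congr rfl fun k _ => ?_
    congr 1
    ext1 ρ
    exact ((Fintype.equivFin ι).symm.sum_comp _).symm
  · rw [← hK, ← (Fintype.equivFin κ).symm.sum_comp]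
    refine Finset.sum_congr rfl fun k _ => ?_
    exact (Fintype.equivFin ι).symm.sum_comp
      (fun j => (K ((Fintype.equivFin κ).symm k) j)ᴴ * K ((Fintype.equivFin κ).symm k) j)

theorem bob_fintype (K : κ → ι → Matrix C B ℂ) (hK : ∑ k, ∑ j, (K k j)ᴴ * K k j = 1)
    (J : κ → O → Matrix (A × C) (A × C) ℂ →ₗ[ℂ] Matrix (A' × B') (A' × B') ℂ)
    (hJ : ∀ k, IsLOCC A C (J k)) :
    IsLOCC A B (fun o => ∑ k, (J k o).comp (krausMap fun j => (1 : Matrix A A ℂ) ⊗ₖ K k j)) := by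
  convert IsLOCC.bob (fun k j => K ((Fintype.equivFin κ).symm k) ((Fintype.equivFin ι).symm j))
    ?_ (fun k => J ((Fintype.equivFin κ).symm k)) (fun k => hJ _) using 1
  · funext o
    rw [← (Fintype.equivFin κ).symm.sum_comp]
    refine Finset.sum_congr rfl fun k _ => ?_
    congr 1
    ext1 ρ
    exact ((Fintype.equivFin ι).symm.sum_comp _).symm
  · rw [← hK, ← (Fintype.equivFin κ).symm.sum_comp]
    refine Finset.sum_congr rfl fun k _ => ?_
    exact (Fintype.equivFin ι).symm.sum_comp
      (fun j => (K ((Fintype.equivFin κ).symm k) j)ᴴ * K ((Fintype.equivFin κ).symm k) j)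

/-- Alice measures with the Kraus operators `K o`, and the protocol halts. -/
theorem alice_measure [Fintype O] (K : O → Matrix C A ℂ) (hK : ∑ o, (K o)ᴴ * K o = 1) :
    IsLOCC A B (fun o => krausMap fun _ : Unit => K o ⊗ₖ (1 : Matrix B B ℂ)) := by
  convert alice_fintype (B := B) (fun o (_ : Unit) => K o) (by simpa using hK) _
    (fun o => IsLOCC.halt o) using 1
  funext o
  rw [Finset.sum_eq_single o]
  · simp
  · intro b _ hb
    simp [hb.symm]
  · simp

/-- Bob measures with the Kraus operators `K o`, and the protocol halts. -/
theorem bob_measure [Fintype O] (K : O → Matrix C B ℂ) (hK : ∑ o, (K o)ᴴ * K o = 1) :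
    IsLOCC A B (fun o => krausMap fun _ : Unit => (1 : Matrix A A ℂ) ⊗ₖ K o) := by
  convert bob_fintype (A := A) (fun o (_ : Unit) => K o) (by simpa using hK) _
    (fun o => IsLOCC.halt o) using 1
  funext o
  rw [Finset.sum_eq_single o]
  · simp
  · intro b _ hb
    simp [hb.symm]
  · simp

end IsLOCC

/-- One-way protocols are LOCC. -/
theorem isLOCCPOVM_oneWayPOVM {A B O ι : Type} [Fintype A] [DecidableEq A] [Fintype B]
    [DecidableEq B] [Fintype O] [DecidableEq O] [Fintype ι] {E : ι → Matrix A A ℂ}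
    {F : ι → O → Matrix B B ℂ} (hE : IsPOVM E) (hF : ∀ a, IsPOVM (F a)) :
    IsLOCCPOVM (oneWayPOVM E F) := by
  -- A factorization `M = Kᴴ * K` of each effect supplies a Kraus operator realizing it.
  have hroot {n : Type} [Fintype n] [DecidableEq n] {M : Matrix n n ℂ} (hM : M.PosSemidef) :
      ∃ K : Matrix n n ℂ, M = Kᴴ * K := by
    open scoped MatrixOrder in
    exact CStarAlgebra.nonneg_iff_eq_star_mul_self.mp hM.nonneg
  choose e he using fun a => hroot (hE.1 a)
  choose f hf using fun a o => hroot ((hF a).1 o)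
  refine ⟨A, B, inferInstance, inferInstance, _,
    IsLOCC.alice_fintype (fun a (_ : Unit) => e a) (by simpa [← he] using hE.2) _
      (fun a => IsLOCC.bob_measure (f a) (by simpa [← hf] using (hF a).2)), fun o ρ => ?_⟩
  simp only [LinearMap.sum_apply, LinearMap.comp_apply, Matrix.trace_sum, oneWayPOVM,
    Finset.sum_mul]
  refine Finset.sum_congr rfl fun a _ => ?_
  rw [trace_krausMap, Fintype.sum_unique, Matrix.trace_mul_comm, krausMap_apply,
    Fintype.sum_unique, Matrix.mul_assoc, Matrix.mul_assoc, Matrix.trace_mul_comm,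
    Matrix.mul_assoc, Matrix.trace_mul_comm]
  congr 1
  rw [Matrix.mul_assoc, ← Matrix.mul_assoc]
  congr 1
  simp only [Matrix.conjTranspose_kronecker, Matrix.conjTranspose_one,
      ← Matrix.mul_kronecker_mul, Matrix.one_mul, Matrix.mul_one, he, hf]

/-! ### Bounds on the LOCC success probability -/

theorem trace_mul_proj {n : Type} [Fintype n] (M : Matrix n n ℂ) (v : n → ℂ) :
    (M * proj v).trace = star v ⬝ᵥ (M *ᵥ v) := by
  rw [proj, Matrix.mul_vecMulVec, Matrix.trace_vecMulVec, dotProduct_comm]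

theorem mul_proj_mul_conjTranspose {m n : Type} [Fintype n] (K : Matrix m n ℂ) (v : n → ℂ) :
    K * proj v * Kᴴ = proj (K *ᵥ v) := by
  rw [proj, proj, Matrix.mul_vecMulVec, Matrix.vecMulVec_mul, Matrix.star_mulVec]

theorem trace_proj {n : Type} [Fintype n] (v : n → ℂ) :
    (proj v).trace = ((∑ i, ‖v i‖ ^ 2 : ℝ) : ℂ) := by
  rw [proj, Matrix.trace_vecMulVec, dotProduct, Complex.ofReal_sum]
  refine Finset.sum_congr rfl fun i _ => ?_
  rw [Pi.star_apply, Complex.star_def, Complex.mul_conj']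
  simp

theorem trace_mul_conjTranspose {m n : Type} [Fintype m] [Fintype n] (K : Matrix m n ℂ) :
    (K * Kᴴ).trace = ((∑ i, ∑ j, ‖K i j‖ ^ 2 : ℝ) : ℂ) := by
  rw [Matrix.trace, Complex.ofReal_sum]
  refine Finset.sum_congr rfl fun i _ => ?_
  rw [Matrix.diag_apply, Matrix.mul_apply, Complex.ofReal_sum]
  refine Finset.sum_congr rfl fun j _ => ?_
  rw [Matrix.conjTranspose_apply, Complex.star_def, Complex.mul_conj']
  simp

/-- Submultiplicativity of the Frobenius norm, by Cauchy–Schwarz on each entry. -/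
theorem sum_norm_sq_mul_le {l m n : Type} [Fintype l] [Fintype m] [Fintype n]
    (K : Matrix l m ℂ) (L : Matrix m n ℂ) :
    ∑ i, ∑ j, ‖(K * L) i j‖ ^ 2 ≤ (∑ i, ∑ k, ‖K i k‖ ^ 2) * ∑ k, ∑ j, ‖L k j‖ ^ 2 := by
  rw [Finset.sum_mul, Finset.sum_comm (s := (Finset.univ : Finset m))]
  refine Finset.sum_le_sum fun i _ => ?_
  rw [Finset.mul_sum]
  refine Finset.sum_le_sum fun j _ => ?_
  rw [Matrix.mul_apply]
  calc ‖∑ k, K i k * L k j‖ ^ 2 ≤ (∑ k, ‖K i k‖ * ‖L k j‖) ^ 2 := by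
        gcongr
        exact (norm_sum_le _ _).trans (le_of_eq (Finset.sum_congr rfl fun k _ => norm_mul _ _))
    _ ≤ _ := Finset.sum_mul_sq_le_sq_mul_sq _ _ _

theorem sum_norm_sq_mul_pauliN {b : Type} [Fintype b] (L : Matrix b (Qubits N) ℂ)
    (m : Fin N → Label) :
    ∑ i, ∑ j, ‖(L * pauliN m) i j‖ ^ 2 = ∑ i, ∑ j, ‖L i j‖ ^ 2 := by
  have h : (L * pauliN m) * (L * pauliN m)ᴴ = L * Lᴴ := by
    rw [Matrix.conjTranspose_mul, pauliN_conjTranspose, Matrix.mul_assoc,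
      ← Matrix.mul_assoc (pauliN m), pauliN_mul_self, Matrix.one_mul]
  have h2 := trace_mul_conjTranspose (L * pauliN m)
  rw [h, trace_mul_conjTranspose] at h2
  exact_mod_cast h2.symm

/-- A product operator is at most `2 ^ (-N)` times as likely on a Bell state as its trace. -/
theorem sum_norm_sq_kronecker_mulVec_bellN_le {a b : Type} [Fintype a] [Fintype b]
    (K : Matrix a (Qubits N) ℂ) (L : Matrix b (Qubits N) ℂ) (m : Fin N → Label) :
    ∑ x, ‖((K ⊗ₖ L) *ᵥ bellN m) x‖ ^ 2 ≤
      (2 ^ N)⁻¹ * ((∑ i, ∑ j, ‖K i j‖ ^ 2) * ∑ i, ∑ j, ‖L i j‖ ^ 2) := by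
  have hc : ‖((Real.sqrt 2 : ℝ) : ℂ)⁻¹ ^ N‖ ^ 2 = (2 ^ N)⁻¹ := by
    rw [norm_pow, norm_inv, Complex.norm_real, Real.norm_of_nonneg (Real.sqrt_nonneg 2), ← pow_mul,
      mul_comm, pow_mul, inv_pow, Real.sq_sqrt (by norm_num), inv_pow]
  simp only [Fintype.sum_prod_type, kronecker_mulVec_bellN, norm_mul, mul_pow, hc]
  simp only [← Finset.mul_sum]
  refine mul_le_mul_of_nonneg_left ?_ (by positivity)
  rw [Finset.sum_comm, mul_comm]
  refine (sum_norm_sq_mul_le _ _).trans (le_of_eq ?_)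
  rw [sum_norm_sq_mul_pauliN]
  congr 1
  rw [Finset.sum_comm]
  rfl

theorem successProb_eq_trace (p : Label → ℝ) (M : (Fin N → Label) →
    Matrix (Qubits N × Qubits N) (Qubits N × Qubits N) ℂ) :
    successProb p M = ∑ m, prob p m * (M m * proj (bellN m)).trace.re := by
  simp only [successProb, trace_mul_proj]

theorem trace_proj_bellN (m : Fin N → Label) : (proj (bellN m)).trace = 1 := by
  have h2 := trace_mul_conjTranspose (pauliN m)
  rw [pauliN_conjTranspose, pauliN_mul_self, Matrix.trace_one] at h2
  rw [proj, Matrix.trace_vecMulVec, dotProduct, Fintype.sum_prod_type, Finset.sum_comm]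
  have h3 (y x : Qubits N) : bellN m (x, y) * star (bellN m) (x, y) =
      (2 ^ N)⁻¹ * ((‖pauliN m y x‖ ^ 2 : ℝ) : ℂ) := by
    rw [Pi.star_apply, bellN_apply, star_mul', star_pow, star_inv₀, Complex.star_def,
      Complex.conj_ofReal, mul_mul_mul_comm, inv_sqrt_two_pow_mul_self, Complex.mul_conj']
    simp
  simp only [h3, ← Finset.mul_sum]
  push_cast at h2 ⊢
  rw [← h2]
  simp

section

variable {A' B' : Type} [Fintype A'] [Fintype B'] {J : (Fin N → Label) →
  Matrix (Qubits N × Qubits N) (Qubits N × Qubits N) ℂ →ₗ[ℂ] Matrix (A' × B') (A' × B') ℂ}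

theorem IsLOCC.trace_re_nonneg (h : IsLOCC (Qubits N) (Qubits N) J) (o : Fin N → Label)
    {ρ : Matrix (Qubits N × Qubits N) (Qubits N × Qubits N) ℂ} (hρ : ρ.PosSemidef) :
    0 ≤ (J o ρ).trace.re :=
  (Complex.nonneg_iff.mp (h.posSemidef o hρ).trace_nonneg).1

theorem IsLOCC.trace_re_proj_bellN_le_one (h : IsLOCC (Qubits N) (Qubits N) J)
    (m : Fin N → Label) : (J m (proj (bellN m))).trace.re ≤ 1 := by
  have h1 := congrArg Complex.re (h.sum_trace (proj (bellN m)))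
  rw [trace_proj_bellN, Complex.re_sum, Complex.one_re] at h1
  rw [← h1]
  exact Finset.single_le_sum (f := fun o => (J o (proj (bellN m))).trace.re)
    (fun o _ => h.trace_re_nonneg o (proj_posSemidef _)) (Finset.mem_univ m)

/-- The bound holds for each product Kraus operator separately, because its contribution to `(J m
1).trace` is the product of the two squared Frobenius norms. -/
theorem IsLOCC.trace_re_proj_bellN_le (h : IsLOCC (Qubits N) (Qubits N) J)
    (m : Fin N → Label) : (J m (proj (bellN m))).trace.re ≤ (2 ^ N)⁻¹ * (J m 1).trace.re := by
  obtain ⟨ι, _, a, b, hab⟩ := h.exists_kraus m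
  rw [hab, krausMap_apply, krausMap_apply, Matrix.trace_sum, Matrix.trace_sum, Complex.re_sum,
    Complex.re_sum, Finset.mul_sum]
  refine Finset.sum_le_sum fun i _ => ?_
  rw [mul_proj_mul_conjTranspose, trace_proj, Complex.ofReal_re, Matrix.mul_one,
    Matrix.conjTranspose_kronecker, ← Matrix.mul_kronecker_mul, Matrix.trace_kronecker,
    trace_mul_conjTranspose, trace_mul_conjTranspose, ← Complex.ofReal_mul, Complex.ofReal_re]
  exact sum_norm_sq_kronecker_mulVec_bellN_le _ _ _

/-- Trace preservation on the identity gives a total weight of `4 ^ N`, of which the Bell states see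
a fraction of at most `2 ^ (-N)`. -/
theorem IsLOCC.sum_trace_re_proj_bellN_le (h : IsLOCC (Qubits N) (Qubits N) J) :
    ∑ m, (J m (proj (bellN m))).trace.re ≤ 2 ^ N := by
  refine (Finset.sum_le_sum fun m _ => h.trace_re_proj_bellN_le m).trans (le_of_eq ?_)
  have h1 : (Fintype.card (Qubits N × Qubits N) : ℂ) = ((2 ^ N * 2 ^ N : ℝ) : ℂ) := by simp
  rw [← Finset.mul_sum, ← Complex.re_sum, h.sum_trace, Matrix.trace_one, h1, Complex.ofReal_re,
    ← mul_assoc, inv_mul_cancel₀ (by positivity), one_mul]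

end

/-! ### Elementary properties of the suprema. -/

theorem exists_isLOCC_of_isLOCCPOVM (p : Label → ℝ) {M : (Fin N → Label) →
    Matrix (Qubits N × Qubits N) (Qubits N × Qubits N) ℂ} (hM : IsLOCCPOVM M) :
    ∃ (A' B' : Type) (_ : Fintype A') (_ : Fintype B') (J : (Fin N → Label) →
      Matrix (Qubits N × Qubits N) (Qubits N × Qubits N) ℂ →ₗ[ℂ] Matrix (A' × B') (A' × B') ℂ),
      IsLOCC (Qubits N) (Qubits N) J ∧
        successProb p M = ∑ m, prob p m * (J m (proj (bellN m))).trace.re := by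
  obtain ⟨A', B', iA, iB, J, hJ, h⟩ := hM
  exact ⟨A', B', iA, iB, J, hJ, by simp only [successProb_eq_trace, h]⟩

theorem successProb_mem_Icc {p : Label → ℝ} (hp : p ∈ stdSimplex ℝ Label) {M : (Fin N → Label) →
    Matrix (Qubits N × Qubits N) (Qubits N × Qubits N) ℂ} (hM : IsLOCCPOVM M) :
    successProb p M ∈ Set.Icc 0 1 := by
  obtain ⟨A', B', _, _, J, hJ, h⟩ := exists_isLOCC_of_isLOCCPOVM p hM
  rw [h]
  refine ⟨Finset.sum_nonneg fun m _ => mul_nonneg (prob_nonneg hp m)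
    (hJ.trace_re_nonneg m (proj_posSemidef _)), ?_⟩
  rw [← sum_prob hp N]
  exact Finset.sum_le_sum fun m _ =>
    mul_le_of_le_one_right (prob_nonneg hp m) (hJ.trace_re_proj_bellN_le_one m)

theorem bddAbove_successProb {p : Label → ℝ} (hp : p ∈ stdSimplex ℝ Label) (N : ℕ) :
    BddAbove {x | ∃ M : (Fin N → Label) → Matrix (Qubits N × Qubits N) (Qubits N × Qubits N) ℂ,
      IsLOCCPOVM M ∧ x = successProb p M} := by
  refine ⟨1, ?_⟩
  rintro x ⟨M, hM, rfl⟩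
  exact (successProb_mem_Icc hp hM).2

theorem le_gammaLOCC {p : Label → ℝ} (hp : p ∈ stdSimplex ℝ Label) {M : (Fin N → Label) →
    Matrix (Qubits N × Qubits N) (Qubits N × Qubits N) ℂ} (hM : IsLOCCPOVM M) :
    successProb p M ≤ gammaLOCC p N :=
  le_csSup (bddAbove_successProb hp N) ⟨M, hM, rfl⟩

theorem gammaLOCC_nonneg {p : Label → ℝ} (hp : p ∈ stdSimplex ℝ Label) (N : ℕ) :
    0 ≤ gammaLOCC p N := by
  refine Real.sSup_nonneg ?_
  rintro x ⟨M, hM, rfl⟩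
  exact (successProb_mem_Icc hp hM).1

theorem gammaLOCC_le_one {p : Label → ℝ} (hp : p ∈ stdSimplex ℝ Label) (N : ℕ) :
    gammaLOCC p N ≤ 1 := by
  refine Real.sSup_le ?_ zero_le_one
  rintro x ⟨M, hM, rfl⟩
  exact (successProb_mem_Icc hp hM).2

theorem gammaOneWay_le_gammaLOCC {p : Label → ℝ} (hp : p ∈ stdSimplex ℝ Label) (N : ℕ) :
    gammaOneWay p N ≤ gammaLOCC p N := by
  refine Real.sSup_le ?_ (gammaLOCC_nonneg hp N)
  rintro x ⟨r, E, F, hE, hF, rfl⟩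
  exact le_gammaLOCC hp (isLOCCPOVM_oneWayPOVM hE hF)

theorem le_gammaOneWay {p : Label → ℝ} (hp : p ∈ stdSimplex ℝ Label) {ι : Type} [Fintype ι]
    {E : ι → Matrix (Qubits N) (Qubits N) ℂ}
    {F : ι → (Fin N → Label) → Matrix (Qubits N) (Qubits N) ℂ} (hE : IsPOVM E)
    (hF : ∀ a, IsPOVM (F a)) : successProb p (oneWayPOVM E F) ≤ gammaOneWay p N := by
  refine le_csSup ⟨1, ?_⟩ ⟨Fintype.card ι, fun a => E ((Fintype.equivFin ι).symm a),
    fun a => F ((Fintype.equivFin ι).symm a), ⟨fun a => hE.1 _, ?_⟩, fun a => hF _, ?_⟩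
  · rintro x ⟨r, E, F, hE, hF, rfl⟩
    exact (successProb_mem_Icc hp (isLOCCPOVM_oneWayPOVM hE hF)).2
  · rw [← hE.2]
    exact (Fintype.equivFin ι).symm.sum_comp E
  · congr 1
    funext o
    exact ((Fintype.equivFin ι).symm.sum_comp fun a => E a ⊗ₖ F a o).symm

theorem card_prob_ne_zero (p : Label → ℝ) (N : ℕ) :
    (Finset.univ.filter fun m : Fin N → Label => prob p m ≠ 0).card =
      (Finset.univ.filter fun m => p m ≠ 0).card ^ N := by
  have h : (Finset.univ.filter fun m : Fin N → Label => prob p m ≠ 0) =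
      Fintype.piFinset fun _ => Finset.univ.filter fun m => p m ≠ 0 := by
    ext m
    simp [prob, Finset.prod_ne_zero_iff]
  rw [h, Fintype.card_piFinset]
  simp

/-- More than `2 ^ N` maximally entangled states cannot be distinguished by LOCC. -/
theorem gammaLOCC_lt_one {p : Label → ℝ} (hp : p ∈ stdSimplex ℝ Label)
    (h3 : 3 ≤ (Finset.univ.filter fun m => p m ≠ 0).card) (hN : 1 ≤ N) : gammaLOCC p N < 1 := by
  set S := Finset.univ.filter fun m : Fin N → Label => prob p m ≠ 0
  have hS : 2 ^ N < S.card := by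
    rw [card_prob_ne_zero]
    -- The strict inequality `2 ^ N < 3 ^ N` requires `1 ≤ N`.
    exact (Nat.pow_lt_pow_left (by norm_num) (by omega)).trans_le (Nat.pow_le_pow_left h3 N)
  have hS0 : S.Nonempty := Finset.card_pos.mp (pos_of_gt hS)
  obtain ⟨m₀, hm₀, hmin⟩ := S.exists_min_image (prob p) hS0
  have hq : 0 < prob p m₀ :=
    lt_of_le_of_ne (prob_nonneg hp _) (Finset.mem_filter.mp hm₀).2.symm
  have hS' : (0 : ℝ) < S.card - 2 ^ N := sub_pos.mpr (mod_cast hS)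
  have hlt : 1 - prob p m₀ * (S.card - 2 ^ N) < 1 := sub_lt_self _ (mul_pos hq hS')
  -- The deficit is the same for all protocols, so the supremum itself stays below 1. The maximum
  -- with 0 is there because `Real.sSup_le` asks for a nonnegative bound, the empty supremum being
  -- 0.
  refine lt_of_le_of_lt (b := max 0 (1 - prob p m₀ * (S.card - 2 ^ N)))
    (Real.sSup_le ?_ (le_max_left _ _)) (max_lt one_pos hlt)
  rintro x ⟨M, hM, rfl⟩
  refine le_trans ?_ (le_max_right _ _)
  obtain ⟨A', B', _, _, J, hJ, h⟩ := exists_isLOCC_of_isLOCCPOVM p hM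
  rw [h, le_sub_comm]
  set y : (Fin N → Label) → ℝ := fun m => (J m (proj (bellN m))).trace.re
  have hy1 : ∀ m, y m ≤ 1 := hJ.trace_re_proj_bellN_le_one
  have hy : ∑ m ∈ S, y m ≤ 2 ^ N :=
    (Finset.sum_le_sum_of_subset_of_nonneg (Finset.subset_univ S)
      fun m _ _ => hJ.trace_re_nonneg m (proj_posSemidef _)).trans hJ.sum_trace_re_proj_bellN_le
  calc prob p m₀ * (S.card - 2 ^ N) ≤ prob p m₀ * ∑ m ∈ S, (1 - y m) := by
        refine mul_le_mul_of_nonneg_left ?_ hq.le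
        rw [Finset.sum_sub_distrib, Finset.sum_const, nsmul_eq_mul, mul_one]
        linarith
    _ ≤ ∑ m ∈ S, prob p m * (1 - y m) := by
        rw [Finset.mul_sum]
        exact Finset.sum_le_sum fun m hm =>
          mul_le_mul_of_nonneg_right (hmin m hm) (sub_nonneg.mpr (hy1 m))
    _ ≤ ∑ m, prob p m * (1 - y m) :=
        Finset.sum_le_sum_of_subset_of_nonneg (Finset.subset_univ S)
          fun m _ _ => mul_nonneg (prob_nonneg hp m) (sub_nonneg.mpr (hy1 m))
    _ = 1 - ∑ m, prob p m * y m := by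
        simp only [mul_sub, mul_one, Finset.sum_sub_distrib, sum_prob hp]

/-! ### The repeated game -/

theorem tensorPow_bellGameTest (N : ℕ) : tensorPow N bellGameTest =
    Matrix.diagonal fun x => if x.1.1 = x.2 ∧ x.1.2 = x.2 then 1 else 0 := by
  ext ⟨⟨a, b⟩, r⟩ ⟨⟨a', b'⟩, r'⟩
  simp only [tensorPow, bellGameTest_eq, Matrix.of_apply, Matrix.diagonal_apply, Prod.mk.injEq]
  simp only [← ite_and]
  rw [Fintype.prod_ite_zero]
  simp only [Finset.prod_const_one, funext_iff, forall_and]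

theorem tensorPow_bellGameState (p : Label → ℝ) (m : Fin N → Label) :
    (Matrix.of fun u v => tensorPow N (bellGameState p) (u, m) (v, m)) =
      (prob p m : ℂ) • proj (bellN m) := by
  have h (a : Label) (i j : Fin 2 × Fin 2) : bellGameState p (i, a) (j, a) =
      p a * (bell a i * star (bell a j)) := by
    simp only [bellGameState, Matrix.sum_apply, Matrix.smul_apply, Matrix.kroneckerMap_apply,
      ketbra, Matrix.single_apply, proj, Matrix.vecMulVec_apply, Pi.star_apply]
    rw [Finset.sum_eq_single a]
    · simp
    · intro b _ hb
      simp [hb]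
    · simp
  ext u v
  simp only [Matrix.of_apply, tensorPow, h, Finset.prod_mul_distrib, prob, Matrix.smul_apply, proj,
    Matrix.vecMulVec_apply, Pi.star_apply, bellN, star_prod, smul_eq_mul, Complex.ofReal_prod]

/-- The winning probability of a strategy in the repeated game. -/
theorem trace_tensorPow_bellGame (p : Label → ℝ)
    (M : Matrix (Qubits N × Qubits N) (Qubits N × Qubits N) ℂ →ₗ[ℂ]
      Matrix ((Fin N → Label) × (Fin N → Label)) ((Fin N → Label) × (Fin N → Label)) ℂ) :
    (tensorPow N bellGameTest * ampliate M (tensorPow N (bellGameState p))).trace.re =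
      ∑ m, prob p m * (M (proj (bellN m)) (m, m) (m, m)).re := by
  rw [tensorPow_bellGameTest, Matrix.trace]
  simp only [Matrix.diag_apply, Matrix.diagonal_mul, ampliate, Matrix.of_apply,
    tensorPow_bellGameState, map_smul, Matrix.smul_apply, smul_eq_mul]
  rw [Fintype.sum_prod_type_right, Complex.re_sum]
  refine Finset.sum_congr rfl fun m _ => ?_
  rw [Finset.sum_eq_single (m, m)]
  · simp
  · rintro ⟨a, b⟩ _ hab
    rw [if_neg, zero_mul]
    exact fun h => hab (Prod.ext h.1 h.2)
  · simp

/-- Measuring the labels turns a strategy into a measurement. -/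
theorem trace_tensorPow_bellGame_le_gammaLOCC {p : Label → ℝ} (hp : p ∈ stdSimplex ℝ Label)
    {M : Matrix (Qubits N × Qubits N) (Qubits N × Qubits N) ℂ →ₗ[ℂ]
      Matrix ((Fin N → Label) × (Fin N → Label)) ((Fin N → Label) × (Fin N → Label)) ℂ}
    (hM : IsLOCCChannel M) :
    (tensorPow N bellGameTest * ampliate M (tensorPow N (bellGameState p))).trace.re ≤
      gammaLOCC p N := by
  have hM' : IsLOCC (O := Unit) (Qubits N) (Qubits N) fun _ => M := hM
  have hK : ∑ m : Fin N → Label, (Matrix.single m m (1 : ℂ))ᴴ * Matrix.single m m 1 = 1 := by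
    simp [Matrix.conjTranspose_single, Matrix.sum_single_one]
  have hJ := hM'.bind _ fun _ => IsLOCC.alice_measure (B := Fin N → Label)
    (fun m : Fin N → Label => Matrix.single m m (1 : ℂ)) hK
  obtain ⟨P, hP⟩ := hJ.exists_povm
  refine le_trans ?_ (le_gammaLOCC hp ⟨_, _, inferInstance, inferInstance, _, hJ, hP⟩)
  rw [successProb_eq_trace]
  rw [trace_tensorPow_bellGame]
  refine Finset.sum_le_sum fun m _ => mul_le_mul_of_nonneg_left ?_ (prob_nonneg hp m)
  have hpos := hM'.posSemidef () (proj_posSemidef (bellN m))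
  rw [← hP, Fintype.sum_unique, LinearMap.comp_apply, trace_krausMap, Fintype.sum_unique,
    Matrix.conjTranspose_kronecker, ← Matrix.mul_kronecker_mul, Matrix.conjTranspose_one,
    Matrix.one_mul, Matrix.conjTranspose_single, Matrix.single_mul_single_same, star_one, mul_one]
  have htr : ((Matrix.single m m (1 : ℂ) ⊗ₖ (1 : Matrix (Fin N → Label) (Fin N → Label) ℂ)) *
      M (proj (bellN m))).trace = ∑ l, M (proj (bellN m)) (m, l) (m, l) := by
    rw [Matrix.trace, Fintype.sum_prod_type, Finset.sum_eq_single m]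
    · refine Finset.sum_congr rfl fun l _ => ?_
      rw [Matrix.diag_apply, Matrix.mul_apply, Finset.sum_eq_single (m, l)]
      · simp
      · rintro ⟨a, b⟩ _ hab
        simp only [Matrix.kroneckerMap_apply, Matrix.single_apply, Matrix.one_apply]
        grind
      · simp
    · intro a _ ha
      refine Finset.sum_eq_zero fun l _ => ?_
      rw [Matrix.diag_apply, Matrix.mul_apply]
      refine Finset.sum_eq_zero fun y _ => ?_
      simp [Matrix.kroneckerMap_apply, ha.symm]
    · simp
  rw [htr, Complex.re_sum]
  -- Winning requires both labels to be right, so it is no more likely than Alice's label alone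
  -- being right.
  exact Finset.single_le_sum (f := fun l => (M (proj (bellN m)) (m, l) (m, l)).re)
    (fun l _ => (Complex.nonneg_iff.mp hpos.diag_nonneg).1) (Finset.mem_univ m)

/-- Both parties replace their systems by the label `m`. -/
theorem isLOCC_prepare {A B : Type} [Fintype A] [DecidableEq A] [Fintype B] [DecidableEq B]
    {X : Type} [Fintype X] [DecidableEq X] (m : X) :
    IsLOCC (O := Unit) A B fun _ => (krausMap fun j : B => (1 : Matrix X X ℂ) ⊗ₖ
      Matrix.single m j 1) ∘ₗ (krausMap fun i : A => Matrix.single m i (1 : ℂ) ⊗ₖ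
        (1 : Matrix B B ℂ)) := by
  have hK (n : Type) [Fintype n] [DecidableEq n] :
      ∑ _k : Unit, ∑ j : n, (Matrix.single m j (1 : ℂ))ᴴ * Matrix.single m j (1 : ℂ) = 1 := by
    simp [Matrix.conjTranspose_single, Matrix.sum_single_one]
  convert IsLOCC.alice_fintype (B := B) (fun (_ : Unit) i => Matrix.single m i (1 : ℂ)) (hK A) _
    (fun _ => IsLOCC.bob_fintype (A := X) (fun (_ : Unit) j => Matrix.single m j (1 : ℂ)) (hK B) _
      (fun _ => IsLOCC.halt ())) using 1
  funext o
  ext1 ρ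
  simp

/-- The two local resets compose to the Kraus operators `|m, m⟩⟨i, j|`, which keep nothing of the
input but its trace. -/
theorem prepare_apply {A B : Type} [Fintype A] [DecidableEq A] [Fintype B] [DecidableEq B]
    {X : Type} [Fintype X] [DecidableEq X] (m : X) (ρ : Matrix (A × B) (A × B) ℂ) :
    krausMap (fun j : B => (1 : Matrix X X ℂ) ⊗ₖ Matrix.single m j 1)
      (krausMap (fun i : A => Matrix.single m i (1 : ℂ) ⊗ₖ (1 : Matrix B B ℂ)) ρ) =
    ρ.trace • Matrix.single (m, m) (m, m) 1 := by
  have h (i : A) (j : B) : ((1 : Matrix X X ℂ) ⊗ₖ Matrix.single m j 1) *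
      (Matrix.single m i (1 : ℂ) ⊗ₖ (1 : Matrix B B ℂ)) =
      Matrix.single (m, m) (i, j) 1 := by
    rw [← Matrix.mul_kronecker_mul, Matrix.one_mul, Matrix.mul_one, Matrix.single_kronecker_single,
      mul_one]
  have h2 (i : A) (j : B) : ((1 : Matrix X X ℂ) ⊗ₖ Matrix.single m j 1) *
      ((Matrix.single m i (1 : ℂ) ⊗ₖ (1 : Matrix B B ℂ)) * ρ *
        (Matrix.single m i (1 : ℂ) ⊗ₖ (1 : Matrix B B ℂ))ᴴ) *
      ((1 : Matrix X X ℂ) ⊗ₖ Matrix.single m j 1)ᴴ =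
      ρ (i, j) (i, j) • Matrix.single (m, m) (m, m) 1 := by
    rw [Matrix.mul_assoc, Matrix.mul_assoc, ← Matrix.conjTranspose_mul, h, ← Matrix.mul_assoc,
      ← Matrix.mul_assoc, h, Matrix.conjTranspose_single, Matrix.single_mul_mul_single]
    simp
  rw [krausMap_apply, krausMap_apply]
  simp only [Matrix.mul_sum, Matrix.sum_mul, h2]
  rw [Finset.sum_comm, Matrix.trace, Fintype.sum_prod_type, Finset.sum_smul]
  simp only [Finset.sum_smul, Matrix.diag_apply]

theorem value_bellGame_nonneg {p : Label → ℝ} (hp : p ∈ stdSimplex ℝ Label) (N : ℕ) :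
    0 ≤ (bellGame p hp).value N := by
  refine Real.sSup_nonneg ?_
  rintro x ⟨M, hM, rfl⟩
  refine le_of_le_of_eq ?_ (trace_tensorPow_bellGame p M).symm
  refine Finset.sum_nonneg fun m _ => mul_nonneg (prob_nonneg hp m) ?_
  exact (Complex.nonneg_iff.mp
    (IsLOCC.posSemidef hM () (proj_posSemidef (bellN m))).diag_nonneg).1

/-- For the lower bound, both parties know the final record of the measurement protocol and prepare
it as their answers; a wrong record has no weight on the winning entry. -/
theorem value_bellGame {p : Label → ℝ} (hp : p ∈ stdSimplex ℝ Label) (N : ℕ) :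
    (bellGame p hp).value N = gammaLOCC p N := by
  classical
  refine le_antisymm (Real.sSup_le ?_ (gammaLOCC_nonneg hp N))
    (Real.sSup_le ?_ (value_bellGame_nonneg hp N))
  · rintro x ⟨M, hM, rfl⟩
    exact trace_tensorPow_bellGame_le_gammaLOCC hp hM
  · rintro x ⟨P, ⟨A', B', _, _, J, hJ, hP⟩, rfl⟩
    refine le_csSup ⟨gammaLOCC p N, ?_⟩ ⟨_, hJ.bind _ fun m => isLOCC_prepare m, ?_⟩
    · rintro x ⟨M, hM, rfl⟩
      exact trace_tensorPow_bellGame_le_gammaLOCC hp hM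
    rw [successProb_eq_trace]
    refine Eq.trans ?_ (trace_tensorPow_bellGame p _).symm
    refine Finset.sum_congr rfl fun m _ => ?_
    rw [← hP, LinearMap.sum_apply, Matrix.sum_apply, Finset.sum_eq_single m]
    · rw [LinearMap.comp_apply, LinearMap.comp_apply, prepare_apply]
      simp
    · intro m' _ hm'
      rw [LinearMap.comp_apply, LinearMap.comp_apply, prepare_apply]
      simp [hm']
    · simp

/-! ### The asymptotic success probability -/

theorem exists_stabilizerScheme_tendsto_one {p : Label → ℝ} (hp : p ∈ stdSimplex ℝ Label)
    (hH : entropy p < 1) : ∃ S : (N : ℕ) → StabilizerScheme p N,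
      Filter.Tendsto (fun N => successProb p (oneWayPOVM (S N).alice (S N).bob))
        Filter.atTop (nhds 1) := by
  obtain ⟨s, hs, hs1, hr⟩ := exists_rpow_sum_lt_one hp hH
  choose S hS using fun N => exists_successProb_ge hp N hs hs1
  have hr0 : 0 ≤ (2 : ℝ) ^ (-s) * ∑ a, p a ^ (1 - s) :=
    mul_nonneg (by positivity) (Finset.sum_nonneg fun a _ => Real.rpow_nonneg (hp.1 a) _)
  refine ⟨S, tendsto_of_tendsto_of_tendsto_of_le_of_le ?_ tendsto_const_nhds hS fun N => ?_⟩
  · simpa using ((tendsto_pow_atTop_nhds_zero_of_lt_one hr0 hr).const_mul ((2 : ℝ) ^ s)).const_sub 1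
  · exact (successProb_mem_Icc hp
      (isLOCCPOVM_oneWayPOVM (S N).isPOVM_alice (S N).isPOVM_bob)).2

theorem tendsto_gammaOneWay {p : Label → ℝ} (hp : p ∈ stdSimplex ℝ Label)
    (hH : entropy p < 1) : Filter.Tendsto (gammaOneWay p) Filter.atTop (nhds 1) := by
  obtain ⟨S, hS⟩ := exists_stabilizerScheme_tendsto_one hp hH
  exact tendsto_of_tendsto_of_tendsto_of_le_of_le hS tendsto_const_nhds
    (fun N => le_gammaOneWay hp (S N).isPOVM_alice (S N).isPOVM_bob)
    fun N => (gammaOneWay_le_gammaLOCC hp N).trans (gammaLOCC_le_one hp N)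

theorem tendsto_gammaLOCC {p : Label → ℝ} (hp : p ∈ stdSimplex ℝ Label)
    (hH : entropy p < 1) : Filter.Tendsto (gammaLOCC p) Filter.atTop (nhds 1) :=
  tendsto_of_tendsto_of_tendsto_of_le_of_le (tendsto_gammaOneWay hp hH) tendsto_const_nhds
    (gammaOneWay_le_gammaLOCC hp) (gammaLOCC_le_one hp)

theorem not_parallelRepetition {p : Label → ℝ} (hp : p ∈ stdSimplex ℝ Label)
    (hH : entropy p < 1) (h3 : 3 ≤ (Finset.univ.filter fun m => p m ≠ 0).card) :
    ¬ (bellGame p hp).ParallelRepetition := by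
  intro h
  obtain ⟨c, hc, hlt⟩ := h (by rw [value_bellGame]; exact gammaLOCC_lt_one hp h3 le_rfl)
  -- The case `N = 1` puts `c` above a nonnegative value, so that `c ^ N` tends to 0.
  have hc0 : 0 ≤ c := by
    have h1 := hlt 1 le_rfl
    rw [pow_one] at h1
    exact (value_bellGame_nonneg hp 1).trans h1.le
  refine absurd (le_of_tendsto_of_tendsto (tendsto_gammaLOCC hp hH)
    (tendsto_pow_atTop_nhds_zero_of_lt_one hc0 hc) ?_) (by norm_num)
  filter_upwards [Filter.eventually_ge_atTop 1] with N hN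
  rw [← value_bellGame hp]
  exact (hlt N hN).le

/-- A distribution on the labels of entropy less than one with three nonzero entries. -/
def lowEntropyDistribution : Label → ℝ := fun m =>
  if m = (0, 0) then 15 / 16 else if m = (1, 1) then 0 else 1 / 32

theorem sum_label (f : Label → ℝ) : ∑ m, f m = f (0, 0) + f (0, 1) + f (1, 0) + f (1, 1) := by
  have h : (Finset.univ : Finset Label) = {(0, 0), (0, 1), (1, 0), (1, 1)} := by decide
  rw [h, Finset.sum_insert (by decide), Finset.sum_insert (by decide),
    Finset.sum_insert (by decide), Finset.sum_singleton]
  ring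

theorem lowEntropyDistribution_mem : lowEntropyDistribution ∈ stdSimplex ℝ Label := by
  refine ⟨fun m => ?_, ?_⟩
  · rw [lowEntropyDistribution]
    split_ifs <;> norm_num
  · rw [sum_label]
    norm_num [lowEntropyDistribution]

/-- The two entries `1 / 32` contribute `10 / 32`, and `(15 / 16) ^ 2 ≥ 1 / 2` bounds the remaining
term by `15 / 32`; the total is at most `25 / 32`. -/
theorem entropy_lowEntropyDistribution_lt : entropy lowEntropyDistribution < 1 := by
  have h1 : Real.logb 2 (32⁻¹) = -5 := by
    rw [Real.logb_inv, show (32 : ℝ) = 2 ^ (5 : ℕ) by norm_num, Real.logb_pow,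
      Real.logb_self_eq_one (by norm_num)]
    norm_num
  have h2 : -(1 / 2) ≤ Real.logb 2 (15 / 16) := by
    have h : Real.logb 2 2⁻¹ ≤ Real.logb 2 ((15 / 16) ^ 2) :=
      Real.logb_le_logb_of_le (by norm_num) (by norm_num) (by norm_num)
    rw [Real.logb_pow, Real.logb_inv, Real.logb_self_eq_one (by norm_num)] at h
    push_cast at h
    linarith
  rw [entropy, sum_label]
  norm_num [lowEntropyDistribution, h1]
  linarith

theorem card_lowEntropyDistribution_ne_zero :
    3 ≤ (Finset.univ.filter fun m => lowEntropyDistribution m ≠ 0).card := by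
  have h : ({(0, 0), (0, 1), (1, 0)} : Finset Label) ⊆
      Finset.univ.filter fun m => lowEntropyDistribution m ≠ 0 := by
    intro m hm
    simp only [Finset.mem_insert, Finset.mem_singleton] at hm
    rcases hm with rfl | rfl | rfl <;> simp [lowEntropyDistribution]
  exact le_of_eq_of_le (by decide) (Finset.card_le_card h)

end BellLOCC

end

theorem mainTheorem3 :
    (∀ p : BellLOCC.Label → ℝ, p ∈ stdSimplex ℝ BellLOCC.Label → BellLOCC.entropy p < 1 →
      (∃ S : (N : ℕ) → BellLOCC.StabilizerScheme p N,
        (∀ N, BellLOCC.IsPOVM (S N).alice ∧ ∀ a, BellLOCC.IsPOVM ((S N).bob a)) ∧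
        Filter.Tendsto
          (fun N => BellLOCC.successProb p (BellLOCC.oneWayPOVM (S N).alice (S N).bob))
          Filter.atTop (nhds 1)) ∧
      Filter.Tendsto (fun N => BellLOCC.gammaOneWay p N) Filter.atTop (nhds 1) ∧
      (∀ N : ℕ, BellLOCC.gammaOneWay p N ≤ BellLOCC.gammaLOCC p N) ∧
      Filter.Tendsto (fun N => BellLOCC.gammaLOCC p N) Filter.atTop (nhds 1) ∧
      (3 ≤ (Finset.univ.filter (fun m => p m ≠ 0)).card →
        ∀ N : ℕ, 1 ≤ N → BellLOCC.gammaLOCC p N < 1)) ∧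
    (∀ (p : BellLOCC.Label → ℝ) (hp : p ∈ stdSimplex ℝ BellLOCC.Label),
      (∀ N : ℕ, (BellLOCC.bellGame p hp).value N = BellLOCC.gammaLOCC p N) ∧
      (BellLOCC.entropy p < 1 → 3 ≤ (Finset.univ.filter (fun m => p m ≠ 0)).card →
        (BellLOCC.bellGame p hp).value 1 < 1 ∧
        Filter.Tendsto (fun N => (BellLOCC.bellGame p hp).value N) Filter.atTop (nhds 1) ∧
        ¬ (BellLOCC.bellGame p hp).ParallelRepetition)) ∧
    (∃ p : BellLOCC.Label → ℝ, p ∈ stdSimplex ℝ BellLOCC.Label ∧ BellLOCC.entropy p < 1 ∧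
      3 ≤ (Finset.univ.filter (fun m => p m ≠ 0)).card) := by
  open BellLOCC in
  refine ⟨fun p hp hH => ?_, fun p hp => ⟨value_bellGame hp, fun hH h3 => ⟨?_, ?_,
    not_parallelRepetition hp hH h3⟩⟩, lowEntropyDistribution, lowEntropyDistribution_mem,
    entropy_lowEntropyDistribution_lt, card_lowEntropyDistribution_ne_zero⟩
  · obtain ⟨S, hS⟩ := exists_stabilizerScheme_tendsto_one hp hH
    exact ⟨⟨S, fun N => ⟨(S N).isPOVM_alice, (S N).isPOVM_bob⟩, hS⟩, tendsto_gammaOneWay hp hH,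
      gammaOneWay_le_gammaLOCC hp, tendsto_gammaLOCC hp hH,
      fun h3 N hN => gammaLOCC_lt_one hp h3 hN⟩
  · rw [value_bellGame]
    exact gammaLOCC_lt_one hp h3 le_rfl
  · simpa only [value_bellGame] using tendsto_gammaLOCC hp hH
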